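/- Let $F$ be a finite field with $q\ge n$ elements, let $k\le n$, $\alpha$, $z_{ro},z_{wo},z_{rw}$ be nonnegative integers, and put $z_r=z_{ro}+z_{rw}$, $z_w=z_{wo}+z_{rw}$, $c=3z_{rw}+2z_{wo}+z_{ro}=z_r+2z_w$; assume $z_r<k$. All entropies and amounts of information are in base $q$. A scheme consists of a random secret $S$ (in a finite alphabet) and shares $W_1,\dots,W_n\in F^\alpha$ with a joint law such that $H(S\mid W_Z)=H(S)$ for all $Z\subseteq[n]$ with $|Z|=z_r$ (privacy) and $H(S\mid W_A)=0$ for all $A\subseteq[n]$ with $|A|=k$ (resiliency). It has error at most $\varepsilon$ if, for every $k$ parties, a user that downloads their whole shares has a decoder that errs with probability at most $\varepsilon$ whichever at most $z_w$ parties an omniscient adversary (knowing $S$ and all shares) corrupts and whatever these parties send instead. A user that contacts a set $D$ of $d$ parties, $k\le d\le n$, uses a protocol: each $i\in D$ reads a fixed set of symbols of $W_i$, sends a function of these symbols, and the user decodes from the (possibly corrupted) messages; the read cost is the total number of symbols read, and the communication cost is $\sum_{i\in D}\log_q$ of the number of possible messages of $i$. The error of such a protocol is measured against the same adversary. **Capacity.**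 The capacity, i.e. the largest $H$ such that for every $\varepsilon>0$ there is a scheme with error at most $\varepsilon$ and $H(S)\ge H$, is $$C^{\mathrm O}(n,k,\mathbf z)=\begin{cases}(k-z_r-2z_w)\alpha & \text{if } k>3z_{rw}+2z_{wo}+z_{ro},\\ 0&\text{otherwise.}\end{cases}$$ **Costs.** Let $k>c$. For every $D$ with $|D|=d\ge k$, if for every $\varepsilon>0$ there are a scheme with $H(S)\ge C^{\mathrm O}$ and error at most $\varepsilon$ and a protocol for $D$ with error at most $\varepsilon$ and communication cost (respectively read cost) at most $\kappa$, then $$\kappa\ \ge\ d\,\frac{(k-3z_{rw}-2z_{wo}-z_{ro})\alpha}{d-3z_{rw}-2z_{wo}-z_{ro}}.$$ If moreover $\frac{(k-c)\alpha}{d-c}$ is an integer for every $d\in\{k,\dots,n\}$, then the minimum of these $\kappa$ equals the right-hand side, so $$\mathrm{RC}(d)=\mathrm{CC}(d)=d\,\frac{(k-3z_{rw}-2z_{wo}-z_{ro})\alpha}{d-3z_{rw}-2z_{wo}-z_{ro}},$$ and there is a single scheme, with zero error, with $H(S)=C^{\mathrm O}$, and with zero-error protocols of exactly these read and communication costs for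 all $D$ with $|D|\ge k$. **Staircase codes.** In the last case, for any distinct nonzero $x_1,\dots,x_n\in F$ (which exist if $q>n$), the following Staircase code is such a scheme. Put $t=k-2z_w$, $N=n-2z_w$, $z=z_r$, $\alpha_e=\frac{(t-z)\alpha}{e-z}$ for $t\le e\le N$. Let $M=[M_N\mid M_{N-1}\mid\cdots\mid M_t]$ be the $N\times\alpha$ matrix over $F$ in which the blocks $M_N,\dots,M_e$ together have $\alpha_e$ columns; $M_N$ has the symbols of the secret in its first $N-z$ rows and random symbols in the other $z$ rows; and $M_e$, for $t\le e<N$, has in its first $e-z$ rows the $(e+1)$-th row of $[M_N\mid\cdots\mid M_{e+1}]$ wrapped around, random symbols in the next $z$ rows, and zeros below. All secret and random symbols are independent and uniform. The share of party $i$ is the $i$-th row of $VM$, $V=(x_i^{r})_{1\le i\le n,\,0\le r<N}$. A user contacting $d$ parties downloads the first $\alpha_{d-2z_w}$ symbols of each contacted share as they are, and decodes the secret with zero error in the presence of up to $z_w$ corrupted parties. -/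

import Mathlib

open scoped BigOperators

universe u

noncomputable section

namespace SecretSharing

/-- Shannon entropy, with logarithms in base `b`, of the random variable `f` under the law `P`. -/
def entropy {A : Type*} {X : Type*} [Fintype X] (b : ℝ) (P : PMF A) (f : A → X) : ℝ :=
  -∑ x : X, (P.map f x).toReal * Real.logb b (P.map f x).toReal

/-- Conditional Shannon entropy `H(f | g) = -∑ p(x,y) log_b (p(x,y) / p(y))` under the law `P`. -/
def condEntropy {A : Type*} {X Y : Type*} [Fintype X] [Fintype Y] (b : ℝ) (P : PMF A)
    (f : A → X) (g : A → Y) : ℝ :=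
  -∑ x : X, ∑ y : Y, (P.map (fun a => (f a, g a)) (x, y)).toReal *
    Real.logb b ((P.map (fun a => (f a, g a)) (x, y)).toReal / (P.map g y).toReal)

/-- A dealer's scheme with `n` parties whose shares consist of `α` symbols of `F`: a finite secret
alphabet and the joint law of the secret and of the `n` shares. -/
structure Scheme (F : Type u) (n α : ℕ) where
  Secret : Type u
  [fintypeSecret : Fintype Secret]
  law : PMF (Secret × (Fin n → Fin α → F))

attribute [instance] Scheme.fintypeSecret

/-- A non-interactive protocol by which a user that contacts the parties in `D` recovers the
secret: party `i ∈ D` reads the symbols of its share at the positions `read i`, and sends a message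
that is a function of these symbols only; the user decodes from the messages it receives. -/
structure Protocol {F : Type u} {n α : ℕ} (C : Scheme F n α) (D : Finset (Fin n)) where
  read : D → Finset (Fin α)
  Msg : D → Type u
  [fintypeMsg : ∀ i, Fintype (Msg i)]
  send : ∀ i : D, (read i → F) → Msg i
  decode : (∀ i : D, Msg i) → C.Secret

attribute [instance] Protocol.fintypeMsg

namespace Protocol

variable {F : Type u} {n α : ℕ} {C : Scheme F n α} {D : Finset (Fin n)}

/-- Total number of symbols read by the contacted parties. -/
def readCost (p : Protocol C D) : ℝ := ∑ i : D, ((p.read i).card : ℝ)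

/-- Total amount of information, in symbols of `F`, sent by the contacted parties. -/
def commCost [Fintype F] (p : Protocol C D) : ℝ :=
  ∑ i : D, Real.logb (Fintype.card F) (Fintype.card (p.Msg i))

/-- What the user receives when the shares are `w`, the parties in `T` are malicious, and `y` is
what the adversary makes the malicious parties send. -/
def received (p : Protocol C D) (w : Fin n → Fin α → F) (T : Finset (Fin n))
    (y : ∀ i : D, p.Msg i) : ∀ i : D, p.Msg i :=
  fun i => if (i : Fin n) ∈ T then y i else p.send i (fun j => w i j)

/-- The probability that the decoded secret is wrong, when the parties in `T` are malicious and the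
omniscient adversary chooses their messages by the rule `forge`, knowing the secret and all
shares. -/
def errorProb (p : Protocol C D) (T : Finset (Fin n))
    (forge : C.Secret × (Fin n → Fin α → F) → ∀ i : D, p.Msg i) : ℝ :=
  (C.law.toOuterMeasure {x | p.decode (p.received x.2 T (forge x)) ≠ x.1}).toReal

/-- Whichever (at most) `zw` parties an omniscient adversary corrupts, and however it does it, the
user decodes a wrong secret with probability at most `ε`. -/
def ErrorAtMost (p : Protocol C D) (zw : ℕ) (ε : ℝ) : Prop :=
  ∀ T : Finset (Fin n), T.card ≤ zw →
    ∀ forge : C.Secret × (Fin n → Fin α → F) → ∀ i : D, p.Msg i, p.errorProb T forge ≤ ε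

end Protocol

namespace Scheme

variable {F : Type u} {n α : ℕ}

/-- The shares of the parties in `A`. -/
def sharesOf (C : Scheme F n α) (A : Finset (Fin n)) :
    C.Secret × (Fin n → Fin α → F) → A → Fin α → F :=
  fun x i => x.2 i

/-- The size of the secret: its entropy, in symbols of `F`. -/
def size [Fintype F] (C : Scheme F n α) : ℝ := entropy (Fintype.card F) C.law Prod.fst

/-- Perfect privacy: any `zr` shares give no information about the secret. -/
def IsPrivate [Fintype F] (C : Scheme F n α) (zr : ℕ) : Prop :=
  ∀ Z : Finset (Fin n), Z.card = zr →
    condEntropy (Fintype.card F) C.law Prod.fst (C.sharesOf Z) =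
      entropy (Fintype.card F) C.law Prod.fst

/-- Resiliency: any `k` (uncorrupted) shares determine the secret. -/
def IsResilient [Fintype F] (C : Scheme F n α) (k : ℕ) : Prop :=
  ∀ A : Finset (Fin n), A.card = k →
    condEntropy (Fintype.card F) C.law Prod.fst (C.sharesOf A) = 0

/-- The protocol in which each contacted party reads the symbols of its share at the positions in
`R` and sends them as they are. -/
def plainDownload [Fintype F] (C : Scheme F n α) (D : Finset (Fin n)) (R : Finset (Fin α))
    (dec : (D → R → F) → C.Secret) : Protocol C D where
  read := fun _ => R
  Msg := fun _ => R → F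
  send := fun _ v => v
  decode := dec

/-- The scheme is private against `zr` eavesdropped parties, resilient with threshold `k`, and a
user that downloads the whole shares of any `k` parties decodes the secret with probability of error
at most `ε` in the presence of an omniscient adversary that corrupts `zw` parties. -/
def IsReliable [Fintype F] (C : Scheme F n α) (k zr zw : ℕ) (ε : ℝ) : Prop :=
  C.IsPrivate zr ∧ C.IsResilient k ∧
    ∀ A : Finset (Fin n), A.card = k →
      ∃ dec, (C.plainDownload A Finset.univ dec).ErrorAtMost zw ε

end Scheme

/-- The secret sizes `H` that can be shared: for every `ε > 0` there is a scheme with a secret of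
size at least `H` and probability of error at most `ε`. -/
def achievableSizes (F : Type u) [Fintype F] (n k zr zw α : ℕ) : Set ℝ :=
  {H | ∀ ε : ℝ, 0 < ε → ∃ C : Scheme F n α, C.IsReliable k zr zw ε ∧ H ≤ C.size}

/-- The communication costs at which a user contacting the parties in `D` can decode, in schemes
with a secret of size at least `H`, with arbitrarily small probability of error. -/
def commCosts (F : Type u) [Fintype F] (n k zr zw α : ℕ) (H : ℝ) (D : Finset (Fin n)) : Set ℝ :=
  {κ | ∀ ε : ℝ, 0 < ε → ∃ C : Scheme F n α, C.IsReliable k zr zw ε ∧ H ≤ C.size ∧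
    ∃ p : Protocol C D, p.ErrorAtMost zw ε ∧ p.commCost ≤ κ}

/-- The read costs at which a user contacting the parties in `D` can decode, in schemes with a
secret of size at least `H`, with arbitrarily small probability of error. -/
def readCosts (F : Type u) [Fintype F] (n k zr zw α : ℕ) (H : ℝ) (D : Finset (Fin n)) : Set ℝ :=
  {κ | ∀ ε : ℝ, 0 < ε → ∃ C : Scheme F n α, C.IsReliable k zr zw ε ∧ H ≤ C.size ∧
    ∃ p : Protocol C D, p.ErrorAtMost zw ε ∧ p.readCost ≤ κ}

/-- The claimed capacity, in symbols of `F`, with `zro` read-only, `zwo` write-only and `zrw`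
read-write parties: `(k - z_r - 2 z_w) α` if `k > 3 z_rw + 2 z_wo + z_ro`, and `0` otherwise. -/
def omniscientCapacity (k zro zwo zrw α : ℕ) : ℝ :=
  if 3 * zrw + 2 * zwo + zro < k then ((k : ℝ) - (zro + zrw) - 2 * (zwo + zrw)) * α else 0

/-- The claimed minimum cost `d (k - c) α / (d - c)`, `c = 3 z_rw + 2 z_wo + z_ro`, of a user that
contacts `d` parties. -/
def optimalCost (k zro zwo zrw α d : ℕ) : ℝ :=
  (d : ℝ) * (((k : ℝ) - 3 * zrw - 2 * zwo - zro) * α) / ((d : ℝ) - 3 * zrw - 2 * zwo - zro)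

/-- Number of symbols sent by each party when `e` parties are contacted, in a Staircase code with
threshold `t`, privacy `z` and shares of `α` symbols. It equals `α` at `e = t`. -/
def stairWidth (t z α e : ℕ) : ℕ := (t - z) * α / (e - z)

/-- The message matrices `M = [M_N | ⋯ | M_{t+1} | M_t]` of the (universal) Staircase code with
parameters `t ≤ N`, `z < t`. The block `M_N` consists of the first `stairWidth t z α N` columns, and
`M_e`, for `t ≤ e < N`, of the columns `c` with `stairWidth t z α (e+1) ≤ c < stairWidth t z α e`.
In `M_N` the first `N - z` rows hold the secret and the other `z` rows are random. In `M_e` with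
`e < N` the first `e - z` rows hold the row `e` (counted from `0`) of the preceding blocks, wrapped
around to fill an `(e - z) × (stairWidth t z α e - stairWidth t z α (e+1))` matrix, the next `z` rows
are random, and the rows from `e` on are zero. -/
structure IsStaircaseMatrix {F : Type u} [Zero F] (t z N α : ℕ) (M : Matrix (Fin N) (Fin α) F) :
    Prop where
  copy : ∀ (e r : Fin N) (c l : Fin α), t ≤ (e : ℕ) →
    stairWidth t z α (e + 1) ≤ (c : ℕ) → (c : ℕ) < stairWidth t z α e → (r : ℕ) + z < e →
    (l : ℕ) = r * (stairWidth t z α e - stairWidth t z α (e + 1)) +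
      (c - stairWidth t z α (e + 1)) →
    M r c = M e l
  zero : ∀ (e r : Fin N) (c : Fin α), t ≤ (e : ℕ) →
    stairWidth t z α (e + 1) ≤ (c : ℕ) → (c : ℕ) < stairWidth t z α e → (e : ℕ) ≤ r →
    M r c = 0

open Classical in
/-- The Staircase code with evaluation points `x`: the secret and the random symbols, that is, the
free entries of the message matrix `M`, are independent and uniform, and party `i` gets the `i`-th
row of `V * M`, where `V` is the Vandermonde matrix of `x`. -/
def staircaseCode {F : Type u} [Field F] [Fintype F] {n : ℕ} (x : Fin n → F) (t z N α : ℕ) :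
    Scheme F n α where
  Secret := {p : Fin N × Fin α // (p.1 : ℕ) + z < N ∧ (p.2 : ℕ) < stairWidth t z α N} → F
  law := (PMF.uniformOfFinset
      (Finset.univ.filter fun M : Matrix (Fin N) (Fin α) F => IsStaircaseMatrix t z N α M)
      ⟨0, by
        simp only [Finset.mem_filter, Finset.mem_univ, true_and]
        exact ⟨fun _ _ _ _ _ _ _ _ _ => rfl, fun _ _ _ _ _ _ _ => rfl⟩⟩).map
    fun M => (fun p => M p.1.1 p.1.2, fun i c => ∑ r : Fin N, x i ^ (r : ℕ) * M r c)

end SecretSharing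

end

/-! Converse. Let `T₁`, `T₂` be disjoint sets of at most `zw` parties. The user cannot distinguish
the run where the truth is `a` and `T₁` imitates `a'` from the run where the truth is `a'` and `T₂`
imitates `a`, if `a` and `a'` agree on the other messages. So those other messages determine the
secret up to error probability `2ε` (`Protocol.exists_guess`). If `Z` is a set of `zr` parties,
privacy gives H(S) = H(S | W_Z), and learning the messages of the set `G` of contacted parties
outside `Z ∪ T₁ ∪ T₂` lowers this by at most their total log-size. What is left is O(√ε) by a
Fano-type bound (`Protocol.size_le_sum_logb`). The constant does not depend on the scheme, because
resiliency allows at most q^(kα) secrets of positive probability, whatever the alphabet; hence ε can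
tend to 0. Whole shares of `k` parties give the capacity bound. For the costs, `G` consists of the d
- c parties with the smallest messages, which carry at most the fraction (d - c)/d of the total.

Achievability. For a secret and shares that depend additively on a uniform element of a subgroup
`W`, everything reduces to two facts. Privacy: every secret is reached by an element of `W` whose
shares vanish on a given `zr`-set (`exists_layout`). Decoding: an element of `W` whose downloaded
symbols vanish at all but `2 zw` contacted parties has secret zero, so `zw` errors can be corrected
(`exists_decode_uniformScheme`). In Staircase codes the second fact is peeling: e parties annihilate
polynomials of degree below e, and the coefficients of higher degree are copies of entries of blocks
already known to vanish (`IsStaircaseLayout.eq_zero`).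

The row map `ρ` serves the case q = n, when 0 may have to be an evaluation point. With the random
entries in the lowest degrees, privacy holds for arbitrary distinct points; the usual order, `ρ =
id`, uses nonzero points. -/

namespace SecretSharing

/-! ### Entropy inequalities and equality cases on finite spaces. -/

section Entropy

variable {A X Y G : Type*}

open Classical in
theorem toReal_map_apply [Fintype A] (P : PMF A) (f : A → X) (x : X) :
    (P.map f x).toReal = ∑ a : A, if f a = x then (P a).toReal else 0 := by
  rw [PMF.map_apply, tsum_fintype, ENNReal.toReal_sum]
  · refine Finset.sum_congr rfl fun a _ => ?_
    by_cases h : f a = x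
    · simp [h]
    · simp [h, Ne.symm h]
  · intro a _
    split_ifs
    · exact P.apply_ne_top a
    · simp

theorem sum_toReal [Fintype A] (P : PMF A) : ∑ a : A, (P a).toReal = 1 := by
  have h := P.tsum_coe
  rw [tsum_fintype] at h
  rw [← ENNReal.toReal_sum fun a _ => P.apply_ne_top a, h, ENNReal.toReal_one]

theorem sum_toReal_map_pair_left [Fintype A] [Fintype X] (P : PMF A) (f : A → X) (g : A → Y)
    (y : Y) : ∑ x : X, (P.map (fun a => (f a, g a)) (x, y)).toReal = (P.map g y).toReal := by
  classical
  simp only [toReal_map_apply, Prod.mk.injEq]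
  rw [Finset.sum_comm]
  refine Finset.sum_congr rfl fun a _ => ?_
  by_cases h : g a = y <;> simp [h]

theorem sum_toReal_map_pair_right [Fintype A] [Fintype Y] (P : PMF A) (f : A → X) (g : A → Y)
    (x : X) : ∑ y : Y, (P.map (fun a => (f a, g a)) (x, y)).toReal = (P.map f x).toReal := by
  classical
  simp only [toReal_map_apply, Prod.mk.injEq]
  rw [Finset.sum_comm]
  refine Finset.sum_congr rfl fun a _ => ?_
  by_cases h : f a = x <;> simp [h]

theorem toReal_map_pair_le_right [Fintype A] [Fintype X] (P : PMF A) (f : A → X) (g : A → Y)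
    (x : X) (y : Y) :
    (P.map (fun a => (f a, g a)) (x, y)).toReal ≤ (P.map g y).toReal := by
  rw [← sum_toReal_map_pair_left P f g y]
  exact Finset.single_le_sum (f := fun x => (P.map (fun a => (f a, g a)) (x, y)).toReal)
    (fun _ _ => ENNReal.toReal_nonneg) (Finset.mem_univ x)

theorem toReal_map_pair_le_left [Fintype A] [Fintype Y] (P : PMF A) (f : A → X) (g : A → Y)
    (x : X) (y : Y) :
    (P.map (fun a => (f a, g a)) (x, y)).toReal ≤ (P.map f x).toReal := by
  rw [← sum_toReal_map_pair_right P f g x]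
  exact Finset.single_le_sum (f := fun y => (P.map (fun a => (f a, g a)) (x, y)).toReal)
    (fun _ _ => ENNReal.toReal_nonneg) (Finset.mem_univ y)

theorem toReal_toOuterMeasure_eq_sum [Fintype A] (P : PMF A) (s : Set A) [DecidablePred (· ∈ s)] :
    (P.toOuterMeasure s).toReal = ∑ a : A, if a ∈ s then (P a).toReal else 0 := by
  classical
  rw [PMF.toOuterMeasure_apply_fintype, ENNReal.toReal_sum]
  · refine Finset.sum_congr rfl fun a _ => ?_
    by_cases h : a ∈ s <;> simp [h]
  · intro a _
    by_cases h : a ∈ s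
    · simpa [h] using P.apply_ne_top a
    · simp [h]

/-- Learning a random variable with values in `G` lowers the entropy by at most `log |G|`. -/
theorem condEntropy_le_logb_card_add [Fintype A] [Fintype X] [Fintype Y] [Fintype G] {b : ℝ}
    (hb : 1 < b) (P : PMF A) (f : A → X) (h : A → Y) (g : A → G) :
    condEntropy b P f h ≤
      Real.logb b (Fintype.card G) + condEntropy b P f (fun a => (h a, g a)) := by
  classical
  have hlb : 0 < Real.log b := Real.log_pos hb
  obtain ⟨a0, -⟩ := P.support_nonempty
  have hG : (0 : ℝ) < Fintype.card G := by
    have : 0 < Fintype.card G := Fintype.card_pos_iff.2 ⟨g a0⟩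
    exact_mod_cast this
  set p : X → Y → G → ℝ := fun x y w => (P.map (fun a => (f a, (h a, g a))) (x, (y, w))).toReal
    with hp
  set pxy : X → Y → ℝ := fun x y => (P.map (fun a => (f a, h a)) (x, y)).toReal with hpxy
  set py : Y → ℝ := fun y => (P.map h y).toReal with hpy
  set pyw : Y → G → ℝ := fun y w => (P.map (fun a => (h a, g a)) (y, w)).toReal with hpyw
  have p0 : ∀ x y w, 0 ≤ p x y w := fun _ _ _ => ENNReal.toReal_nonneg
  have s1 : ∀ x y, ∑ w, p x y w = pxy x y := by
    intro x y
    simp only [hp, hpxy, toReal_map_apply, Prod.mk.injEq]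
    rw [Finset.sum_comm]
    refine Finset.sum_congr rfl fun a _ => ?_
    by_cases h1 : f a = x <;> by_cases h2 : h a = y <;> simp [h1, h2]
  have s2 : ∀ y w, ∑ x, p x y w = pyw y w := fun y w => sum_toReal_map_pair_left P f _ (y, w)
  have s3 : ∀ y, ∑ w, pyw y w = py y := fun y => sum_toReal_map_pair_right P h g y
  have s4 : ∑ y, py y = 1 := by
    simp only [hpy, toReal_map_apply]
    rw [Finset.sum_comm]
    simpa using sum_toReal P
  -- Apply log u ≤ u - 1 to the ratio of the uniform law on `G` to the conditional law of `g` given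
  -- `h`, inverted into u = py / (pyw |G|), and use p ≤ pxy. The correction terms average to at most
  -- 0, by `tot` and `rest`.
  have key : ∀ x y w, - (p x y w * Real.logb b (pxy x y / py y)) ≤
      - (p x y w * Real.logb b (p x y w / pyw y w)) +
        p x y w * (Real.logb b (Fintype.card G) +
          (py y / (pyw y w * Fintype.card G) - 1) / Real.log b) := by
    intro x y w
    rcases (p0 x y w).eq_or_lt with h0 | h0
    · simp [← h0]
    · have hxy : p x y w ≤ pxy x y := by
        rw [← s1 x y]
        exact Finset.single_le_sum (fun w _ => p0 x y w) (Finset.mem_univ w)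
      have hyw : p x y w ≤ pyw y w := by
        rw [← s2 y w]
        exact Finset.single_le_sum (f := fun x => p x y w) (fun x _ => p0 x y w)
          (Finset.mem_univ x)
      have hyy : pyw y w ≤ py y := by
        rw [← s3 y]
        exact Finset.single_le_sum (f := fun w => pyw y w) (fun w _ => ENNReal.toReal_nonneg)
          (Finset.mem_univ w)
      have q1 : 0 < pxy x y := h0.trans_le hxy
      have q2 : 0 < pyw y w := h0.trans_le hyw
      have q3 : 0 < py y := q2.trans_le hyy
      have e := Real.log_le_sub_one_of_pos (x := py y / (pyw y w * Fintype.card G))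
        (by positivity)
      rw [Real.log_div q3.ne' (by positivity), Real.log_mul q2.ne' hG.ne'] at e
      have e2 : Real.log (p x y w) ≤ Real.log (pxy x y) := Real.log_le_log h0 hxy
      have : - Real.logb b (pxy x y / py y) ≤ - Real.logb b (p x y w / pyw y w) +
          (Real.logb b (Fintype.card G) +
            (py y / (pyw y w * Fintype.card G) - 1) / Real.log b) := by
        simp only [Real.logb]
        rw [Real.log_div q1.ne' q3.ne', Real.log_div h0.ne' q2.ne', ← neg_div, ← neg_div,
          ← add_div, ← add_div]
        gcongr
        linarith
      calc _ = p x y w * - Real.logb b (pxy x y / py y) := by ring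
        _ ≤ p x y w * _ := mul_le_mul_of_nonneg_left this h0.le
        _ = _ := by ring
  have lhs : condEntropy b P f h =
      ∑ x, ∑ y, ∑ w, - (p x y w * Real.logb b (pxy x y / py y)) := by
    simp only [condEntropy, Finset.sum_neg_distrib, ← Finset.sum_mul, s1]
    rfl
  have rhs : condEntropy b P f (fun a => (h a, g a)) =
      ∑ x, ∑ y, ∑ w, - (p x y w * Real.logb b (p x y w / pyw y w)) := by
    simp only [condEntropy, Finset.sum_neg_distrib, Fintype.sum_prod_type]
    rfl
  have tot : ∑ x, ∑ y, ∑ w, p x y w = 1 := by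
    rw [Finset.sum_comm, ← s4]
    refine Finset.sum_congr rfl fun y _ => ?_
    rw [Finset.sum_comm, ← s3 y]
    exact Finset.sum_congr rfl fun w _ => s2 y w
  have rest : ∑ x, ∑ y, ∑ w, p x y w * (py y / (pyw y w * Fintype.card G)) ≤ 1 := by
    rw [Finset.sum_comm, ← s4]
    refine Finset.sum_le_sum fun y _ => ?_
    rw [Finset.sum_comm]
    have : ∀ w ∈ Finset.univ, ∑ x, p x y w * (py y / (pyw y w * Fintype.card G)) ≤
        py y / Fintype.card G := by
      intro w _
      rw [← Finset.sum_mul, s2]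
      have hy0 : 0 ≤ py y := ENNReal.toReal_nonneg
      have hw0 : 0 ≤ pyw y w := ENNReal.toReal_nonneg
      clear_value pyw py
      rcases hw0.eq_or_lt with h0 | h0
      · rw [← h0]; simp; positivity
      · apply le_of_eq; field_simp
    refine (Finset.sum_le_sum this).trans ?_
    rw [Finset.sum_const, Finset.card_univ, nsmul_eq_mul]
    apply le_of_eq; field_simp
  calc condEntropy b P f h ≤ ∑ x, ∑ y, ∑ w, (- (p x y w * Real.logb b (p x y w / pyw y w)) +
        p x y w * (Real.logb b (Fintype.card G) +
          (py y / (pyw y w * Fintype.card G) - 1) / Real.log b)) := by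
        rw [lhs]
        exact Finset.sum_le_sum fun x _ => Finset.sum_le_sum fun y _ =>
          Finset.sum_le_sum fun w _ => key x y w
    _ = condEntropy b P f (fun a => (h a, g a)) +
        (Real.logb b (Fintype.card G) * (∑ x, ∑ y, ∑ w, p x y w) +
        ((∑ x, ∑ y, ∑ w, p x y w * (py y / (pyw y w * Fintype.card G))) -
          ∑ x, ∑ y, ∑ w, p x y w) / Real.log b) := by
        rw [rhs]
        simp only [Finset.mul_sum, Finset.sum_div, ← Finset.sum_sub_distrib,
          ← Finset.sum_add_distrib]
        refine Finset.sum_congr rfl fun x _ => Finset.sum_congr rfl fun y _ =>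
          Finset.sum_congr rfl fun w _ => ?_
        ring
    _ ≤ _ := by
        rw [tot, mul_one]
        have : (∑ x, ∑ y, ∑ w, p x y w * (py y / (pyw y w * Fintype.card G)) - 1) / Real.log b
            ≤ 0 := div_nonpos_of_nonpos_of_nonneg (by linarith) hlb.le
        linarith

/-- Writing the left side as 2p log(√m/√p) and using log u ≤ u - 1 bounds it by 2√p(√m - √p). The
first form is small when p is near 0 (a wrong guess), the second when p is near m (a right guess).
-/
theorem neg_mul_log_le_sqrt {p m : ℝ} (hp : 0 ≤ p) (hpm : p ≤ m) :
    -(p * Real.log (p / m)) ≤ 2 * (√m * √p) ∧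
      -(p * Real.log (p / m)) ≤ 2 * (√m * √(m - p)) := by
  rcases hp.eq_or_lt with h0 | h0
  · subst h0
    simp only [zero_mul, neg_zero]
    constructor <;> positivity
  have hm : 0 < m := h0.trans_le hpm
  have e : Real.log (√m / √p) ≤ √m / √p - 1 :=
    Real.log_le_sub_one_of_pos (div_pos (Real.sqrt_pos.2 hm) (Real.sqrt_pos.2 h0))
  have e1 : -(Real.log (p / m)) = 2 * Real.log (√m / √p) := by
    rw [Real.log_div h0.ne' hm.ne', Real.log_div (Real.sqrt_pos.2 hm).ne' (Real.sqrt_pos.2 h0).ne',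
      Real.log_sqrt hm.le, Real.log_sqrt h0.le]
    ring
  have hs : 0 < √p := Real.sqrt_pos.2 h0
  have hsm : √p ≤ √m := Real.sqrt_le_sqrt hpm
  have e2 : -(p * Real.log (p / m)) ≤ 2 * (√p * (√m - √p)) := by
    calc _ = p * (2 * Real.log (√m / √p)) := by rw [← e1]; ring
      _ ≤ p * (2 * (√m / √p - 1)) := by gcongr
      _ = (√p * √p) * (2 * (√m / √p - 1)) := by rw [Real.mul_self_sqrt h0.le]
      _ = _ := by field_simp
  have e3 : √m - √p ≤ √(m - p) := by
    apply Real.le_sqrt_of_sq_le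
    have a1 := Real.sq_sqrt h0.le
    have a2 := Real.sq_sqrt hm.le
    nlinarith
  constructor
  · nlinarith
  · have := Real.sqrt_nonneg (m - p)
    nlinarith

/-- A form of Fano's inequality: the equivocation of a random variable with few values that is
guessed correctly except with small probability is small. -/
theorem condEntropy_le_sqrt [Fintype A] [Fintype X] [Fintype Y] {b δ : ℝ} (hb : 1 < b) {m : ℕ}
    (P : PMF A) (f : A → X) (g : A → Y) (guess : Y → X)
    (supp : Finset X) (hsupp : ∀ x ∉ supp, (P.map f x).toReal = 0) (hm : supp.card ≤ m)
    (hδ : (P.toOuterMeasure {a | f a ≠ guess (g a)}).toReal ≤ δ) :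
    condEntropy b P f g ≤ 2 / Real.log b * (√m * √(2 * δ)) := by
  classical
  have hlb : 0 < Real.log b := Real.log_pos hb
  set p : X → Y → ℝ := fun x y => (P.map (fun a => (f a, g a)) (x, y)).toReal with hp
  set py : Y → ℝ := fun y => (P.map g y).toReal with hpy
  have p0 : ∀ x y, 0 ≤ p x y := fun _ _ => ENNReal.toReal_nonneg
  have py0 : ∀ y, 0 ≤ py y := fun _ => ENNReal.toReal_nonneg
  have ple : ∀ x y, p x y ≤ py y := fun x y => toReal_map_pair_le_right P f g x y
  have s1 : ∀ y, ∑ x, p x y = py y := fun y => sum_toReal_map_pair_left P f g y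
  have s4 : ∑ y, py y = 1 := by
    simp only [hpy, toReal_map_apply]
    rw [Finset.sum_comm]
    simpa using sum_toReal P
  -- For each `y`, `d` measures the distance of the conditional law from certainty of `guess y`. Its
  -- total is twice the error probability, and Cauchy–Schwarz over `supp ×ˢ univ`, where `py` has
  -- mass at most `m`, yields the bound.
  set d : X → Y → ℝ := fun x y => if x = guess y then py y - p x y else p x y with hd
  have d0 : ∀ x y, 0 ≤ d x y := by
    intro x y
    simp only [hd]
    split_ifs
    · linarith [ple x y]
    · exact p0 x y
  have pz : ∀ x ∉ supp, ∀ y, p x y = 0 := fun x hx y =>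
    le_antisymm ((toReal_map_pair_le_left P f g x y).trans (hsupp x hx).le) (p0 x y)
  have e1 : condEntropy b P f g =
      ∑ x ∈ supp, ∑ y, -(p x y * Real.log (p x y / py y)) / Real.log b := by
    rw [Finset.sum_subset (Finset.subset_univ supp)
      (fun x _ hx => by simp [pz x hx])]
    simp only [condEntropy, ← Finset.sum_neg_distrib]
    refine Finset.sum_congr rfl fun x _ => Finset.sum_congr rfl fun y _ => ?_
    simp only [Real.logb, hp, hpy]
    ring
  have e2 : ∀ x y, -(p x y * Real.log (p x y / py y)) ≤ 2 * (√(py y) * √(d x y)) := by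
    intro x y
    have := neg_mul_log_le_sqrt (p0 x y) (ple x y)
    simp only [hd]
    split_ifs
    · exact this.2
    · exact this.1
  have hdsum : ∑ q ∈ supp ×ˢ Finset.univ, d q.1 q.2 ≤ 2 * δ := by
    calc ∑ q ∈ supp ×ˢ Finset.univ, d q.1 q.2
        ≤ ∑ q : X × Y, d q.1 q.2 :=
          Finset.sum_le_sum_of_subset_of_nonneg (Finset.subset_univ _) fun _ _ _ => d0 _ _
      _ = ∑ y, ∑ x, d x y := by rw [Fintype.sum_prod_type, Finset.sum_comm]
      _ = ∑ y, 2 * (py y - p (guess y) y) := by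
          refine Finset.sum_congr rfl fun y _ => ?_
          have h1 : ∀ x, d x y = p x y +
              if x = guess y then (py y - 2 * p (guess y) y) else 0 := by
            intro x
            simp only [hd]
            split_ifs with h
            · rw [h]; ring
            · ring
          simp only [h1, Finset.sum_add_distrib, s1, Finset.sum_ite_eq', Finset.mem_univ, if_true]
          ring
      _ = 2 * (1 - ∑ y, p (guess y) y) := by
          rw [← Finset.mul_sum, Finset.sum_sub_distrib, s4]
      _ ≤ 2 * δ := by
          have h1 : ∑ y, p (guess y) y = ∑ a, if f a = guess (g a) then (P a).toReal else 0 := by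
            simp only [hp, toReal_map_apply, Prod.mk.injEq]
            rw [Finset.sum_comm]
            refine Finset.sum_congr rfl fun a _ => ?_
            rw [Finset.sum_eq_single (g a)]
            · simp
            · intro y _ hy
              simp [Ne.symm hy]
            · simp
          rw [toReal_toOuterMeasure_eq_sum] at hδ
          have h2 := sum_toReal P
          have h3 : ∑ a, (P a).toReal = (∑ a, if f a = guess (g a) then (P a).toReal else 0) +
              ∑ a, if a ∈ {a | f a ≠ guess (g a)} then (P a).toReal else 0 := by
            rw [← Finset.sum_add_distrib]
            refine Finset.sum_congr rfl fun a _ => ?_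
            by_cases h : f a = guess (g a) <;> simp [h]
          rw [h1]
          linarith
  have hpsum : ∑ q ∈ supp ×ˢ (Finset.univ : Finset Y), py q.2 ≤ m := by
    rw [Finset.sum_product]
    simp only [s4, Finset.sum_const, nsmul_eq_mul, mul_one]
    exact_mod_cast hm
  calc condEntropy b P f g
      ≤ ∑ x ∈ supp, ∑ y, 2 / Real.log b * (√(py y) * √(d x y)) := by
        rw [e1]
        refine Finset.sum_le_sum fun x _ => Finset.sum_le_sum fun y _ => ?_
        rw [div_mul_eq_mul_div]
        exact div_le_div_of_nonneg_right (e2 x y) hlb.le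
    _ = 2 / Real.log b * ∑ q ∈ supp ×ˢ Finset.univ, √(py q.2) * √(d q.1 q.2) := by
        rw [Finset.sum_product, Finset.mul_sum]
        simp only [Finset.mul_sum]
    _ ≤ 2 / Real.log b * (√(∑ q ∈ supp ×ˢ (Finset.univ : Finset Y), py q.2) *
          √(∑ q ∈ supp ×ˢ Finset.univ, d q.1 q.2)) := by
        gcongr
        exact Real.sum_sqrt_mul_sqrt_le _ (fun q => py0 q.2) (fun q => d0 q.1 q.2)
    _ ≤ _ := by gcongr

/-- A random variable that has no entropy given `g` is a function of `g`. -/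
theorem eq_of_condEntropy_eq_zero [Fintype A] [Fintype X] [Fintype Y] {b : ℝ} (hb : 1 < b)
    (P : PMF A) (f : A → X) (g : A → Y) (h : condEntropy b P f g = 0) {a a' : A}
    (ha : P a ≠ 0) (ha' : P a' ≠ 0) (hg : g a = g a') : f a = f a' := by
  classical
  set p : X → Y → ℝ := fun x y => (P.map (fun a => (f a, g a)) (x, y)).toReal with hp
  set py : Y → ℝ := fun y => (P.map g y).toReal with hpy
  have p0 : ∀ x y, 0 ≤ p x y := fun _ _ => ENNReal.toReal_nonneg
  have ple : ∀ x y, p x y ≤ py y := fun x y => toReal_map_pair_le_right P f g x y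
  have hpos : ∀ c : A, P c ≠ 0 → 0 < p (f c) (g c) := by
    intro c hc
    have h1 : 0 < (P c).toReal := ENNReal.toReal_pos hc (P.apply_ne_top c)
    refine h1.trans_le ?_
    simp only [hp, toReal_map_apply]
    have := Finset.single_le_sum
      (f := fun a => if (f a, g a) = (f c, g c) then (P a).toReal else 0)
      (fun a _ => by split_ifs <;> simp) (Finset.mem_univ c)
    simpa using this
  have t0 : ∀ x y, 0 ≤ -(p x y * Real.logb b (p x y / py y)) := by
    intro x y
    rw [← mul_neg]
    refine mul_nonneg (p0 x y) (neg_nonneg.2 ?_)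
    exact Real.logb_nonpos hb (div_nonneg (p0 x y) ((p0 x y).trans (ple x y)))
      (div_le_one_of_le₀ (ple x y) ((p0 x y).trans (ple x y)))
  have hz : ∑ x, ∑ y, -(p x y * Real.logb b (p x y / py y)) = 0 := by
    rw [← h]
    simp only [condEntropy, Finset.sum_neg_distrib]
    rfl
  -- All terms of the conditional entropy are nonnegative, so each vanishes; where the joint mass is
  -- positive the conditional probability must be 1.
  have hfull : ∀ c : A, P c ≠ 0 → p (f c) (g c) = py (g c) := by
    intro c hc
    have h1 := (Finset.sum_eq_zero_iff_of_nonneg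
      (fun x _ => Finset.sum_nonneg fun y _ => t0 x y)).1 hz (f c) (Finset.mem_univ _)
    have h2 := (Finset.sum_eq_zero_iff_of_nonneg (fun y _ => t0 (f c) y)).1 h1 (g c)
      (Finset.mem_univ _)
    have h3 := hpos c hc
    have h4 : 0 < py (g c) := h3.trans_le (ple _ _)
    rw [neg_eq_zero, mul_eq_zero, or_iff_right h3.ne'] at h2
    rcases Real.logb_eq_zero.1 h2 with h | h | h | h | h | h
    all_goals first | linarith | skip
    · have := div_pos h3 h4; linarith
    · rwa [div_eq_one_iff_eq h4.ne'] at h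
    · have := div_pos h3 h4; linarith
  by_contra hne
  have h1 := hfull a ha
  have h2 := hpos a' ha'
  rw [← hg] at h2
  have h3 : ∑ x, p x (g a) = py (g a) := sum_toReal_map_pair_left P f g (g a)
  have h4 : p (f a) (g a) + p (f a') (g a) ≤ ∑ x, p x (g a) := by
    rw [← Finset.sum_pair (f := fun x => p x (g a)) hne]
    exact Finset.sum_le_sum_of_subset_of_nonneg (Finset.subset_univ _) fun _ _ _ => p0 _ _
  linarith

theorem condEntropy_eq_zero [Fintype A] [Fintype X] [Fintype Y] (b : ℝ)
    (P : PMF A) (f : A → X) (g : A → Y)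
    (h : ∀ a a', P a ≠ 0 → P a' ≠ 0 → g a = g a' → f a = f a') : condEntropy b P f g = 0 := by
  classical
  rw [condEntropy, neg_eq_zero]
  refine Finset.sum_eq_zero fun x _ => Finset.sum_eq_zero fun y _ => ?_
  by_cases h0 : (P.map (fun a => (f a, g a)) (x, y)).toReal = 0
  · rw [h0, zero_mul]
  have h1 : (P.map (fun a => (f a, g a)) (x, y)).toReal = (P.map g y).toReal := by
    simp only [toReal_map_apply] at h0 ⊢
    obtain ⟨c, -, hc⟩ := Finset.exists_ne_zero_of_sum_ne_zero h0
    have hcp : P c ≠ 0 := by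
      intro h
      simp [h] at hc
    have hcf : (f c, g c) = (x, y) := by
      by_contra h
      simp [h] at hc
    simp only [Prod.mk.injEq] at hcf
    refine Finset.sum_congr rfl fun a _ => ?_
    by_cases hg : g a = y
    · by_cases ha : P a = 0
      · simp [ha]
      · have := h a c ha hcp (hg.trans hcf.2.symm)
        simp [hg, this, hcf.1]
    · simp [hg]
  rw [h1, div_self (h1 ▸ h0)]
  simp

/-- If, given `g`, the random variable `f` is uniform, its equivocation is `log |X|`. -/
theorem condEntropy_eq_logb_card [Fintype A] [Fintype X] [Fintype Y] (b : ℝ)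
    (P : PMF A) (f : A → X) (g : A → Y)
    (h : ∀ x x' y, (P.map (fun a => (f a, g a)) (x, y)).toReal =
      (P.map (fun a => (f a, g a)) (x', y)).toReal) :
    condEntropy b P f g = Real.logb b (Fintype.card X) := by
  classical
  obtain ⟨a0, -⟩ := P.support_nonempty
  have hX : (0 : ℝ) < Fintype.card X := by
    have : 0 < Fintype.card X := Fintype.card_pos_iff.2 ⟨f a0⟩
    exact_mod_cast this
  have h1 : ∀ x y, (P.map (fun a => (f a, g a)) (x, y)).toReal =
      (P.map g y).toReal / Fintype.card X := by
    intro x y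
    rw [← sum_toReal_map_pair_left P f g y, Finset.sum_congr rfl fun x' _ => h x' x y,
      Finset.sum_const, Finset.card_univ, nsmul_eq_mul]
    field_simp
  have s4 : ∑ y, (P.map g y).toReal = 1 := by
    simp only [toReal_map_apply]
    rw [Finset.sum_comm]
    simpa using sum_toReal P
  have h2 : ∀ x y, (P.map (fun a => (f a, g a)) (x, y)).toReal *
      Real.logb b ((P.map (fun a => (f a, g a)) (x, y)).toReal / (P.map g y).toReal) =
      (P.map g y).toReal * (-(Real.logb b (Fintype.card X)) / Fintype.card X) := by
    intro x y
    rw [h1]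
    by_cases h0 : (P.map g y).toReal = 0
    · rw [h0]; simp
    · rw [div_right_comm, div_self h0, one_div, Real.logb_inv]
      ring
  simp only [condEntropy, h2, ← Finset.sum_mul, s4, one_mul, Finset.sum_const, Finset.card_univ,
    nsmul_eq_mul]
  field_simp

theorem entropy_eq_logb_card [Fintype A] [Fintype X] (b : ℝ) (P : PMF A) (f : A → X)
    (h : ∀ x x', (P.map f x).toReal = (P.map f x').toReal) :
    entropy b P f = Real.logb b (Fintype.card X) := by
  classical
  obtain ⟨a0, -⟩ := P.support_nonempty
  have hX : (0 : ℝ) < Fintype.card X := by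
    have : 0 < Fintype.card X := Fintype.card_pos_iff.2 ⟨f a0⟩
    exact_mod_cast this
  have s4 : ∑ y, (P.map f y).toReal = 1 := by
    simp only [toReal_map_apply]
    rw [Finset.sum_comm]
    simpa using sum_toReal P
  have h1 : ∀ x, (P.map f x).toReal = (Fintype.card X : ℝ)⁻¹ := by
    intro x
    rw [Finset.sum_congr rfl fun x' _ => h x' x, Finset.sum_const, Finset.card_univ,
      nsmul_eq_mul] at s4
    exact eq_inv_of_mul_eq_one_right s4
  simp only [entropy, h1, Finset.sum_const, Finset.card_univ, nsmul_eq_mul, Real.logb_inv]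
  field_simp

end Entropy

/-! ### Upper bound on the capacity and lower bounds on the costs. -/

section Converse

variable {F : Type u} {n α : ℕ}

/-- Removing a largest value never raises the mean, so the m smallest values have mean at most that
of all. -/
theorem exists_subset_card_mul_sum_le {ι : Type*} [DecidableEq ι] (f : ι → ℝ) {m : ℕ}
    (s : Finset ι) (hm : m ≤ s.card) :
    ∃ G ⊆ s, G.card = m ∧ (s.card : ℝ) * ∑ i ∈ G, f i ≤ m * ∑ i ∈ s, f i := by
  induction hd : s.card - m generalizing s with
  | zero => exact ⟨s, Finset.Subset.refl _, by omega, by rw [show s.card = m by omega]⟩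
  | succ k ih =>
    obtain ⟨x, hx, hmax⟩ := s.exists_max_image f (Finset.card_pos.1 (by omega))
    have hc := Finset.card_erase_of_mem hx
    obtain ⟨G, hG, hGm, hle⟩ := ih (s.erase x) (by omega) (by omega)
    refine ⟨G, hG.trans (Finset.erase_subset _ _), hGm, ?_⟩
    have hsum := Finset.add_sum_erase s f hx
    have hGx : ∑ i ∈ G, f i ≤ m * f x := by
      rw [← hGm, ← nsmul_eq_mul]
      exact Finset.sum_le_card_nsmul _ _ _ fun i hi =>
        hmax i (Finset.mem_of_mem_erase (hG hi))
    have hcr : (s.card : ℝ) = (s.erase x).card + 1 := by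
      rw [hc]
      have : s.card - 1 + 1 = s.card := by omega
      exact_mod_cast this.symm
    rw [hcr, ← hsum]
    linarith

/-- The messages that the contacted parties send when no party is malicious. -/
def Protocol.messages {C : Scheme F n α} {D : Finset (Fin n)} (p : Protocol C D)
    (w : Fin n → Fin α → F) : ∀ i : D, p.Msg i :=
  fun i => p.send i fun j => w i j

/-- The parties outside `T₁ ∪ T₂` determine the secret with small probability of error, since the
user cannot tell which of `T₁` and `T₂` is malicious. -/
theorem Protocol.exists_guess [Fintype F] {C : Scheme F n α} {D : Finset (Fin n)}
    (p : Protocol C D) {zw : ℕ} {ε : ℝ} (hp : p.ErrorAtMost zw ε) {T₁ T₂ : Finset (Fin n)}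
    (hT : Disjoint T₁ T₂) (h₁ : T₁.card ≤ zw) (h₂ : T₂.card ≤ zw) {Y : Type*}
    (g : C.Secret × (Fin n → Fin α → F) → Y)
    (hg : ∀ a a', g a = g a' → ∀ i : D, (i : Fin n) ∉ T₁ → (i : Fin n) ∉ T₂ →
      p.messages a.2 i = p.messages a'.2 i) :
    ∃ guess : Y → C.Secret,
      (C.law.toOuterMeasure {a | a.1 ≠ guess (g a)}).toReal ≤ 2 * ε := by
  classical
  obtain ⟨a₀, -⟩ := C.law.support_nonempty
  let word : C.Secret × (Fin n → Fin α → F) → C.Secret × (Fin n → Fin α → F) →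
    Finset (Fin n) → ∀ i : D, p.Msg i := fun a a' T => p.received a.2 T (p.messages a'.2)
  -- An outcome is bad for `T` if some outcome with the same view, imitated by `T`, makes the user
  -- err. An omniscient adversary sees the outcome and can choose such an imitation, so bad outcomes
  -- have probability at most `ε`.
  let bad : Finset (Fin n) → C.Secret × (Fin n → Fin α → F) → Prop :=
    fun T a => ∃ a', g a = g a' ∧ p.decode (word a a' T) ≠ a.1
  have hbad : ∀ T : Finset (Fin n), T.card ≤ zw →
      (C.law.toOuterMeasure {a | bad T a}).toReal ≤ ε := by
    intro T hTc
    let forge : C.Secret × (Fin n → Fin α → F) → ∀ i : D, p.Msg i :=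
      fun a => if h : bad T a then p.messages h.choose.2 else p.messages a.2
    refine le_trans ?_ (hp T hTc forge)
    rw [Protocol.errorProb, toReal_toOuterMeasure_eq_sum, toReal_toOuterMeasure_eq_sum]
    refine Finset.sum_le_sum fun a _ => ?_
    by_cases h : bad T a
    · have : p.decode (p.received a.2 T (forge a)) ≠ a.1 := by
        simp only [forge, dif_pos h]
        exact h.choose_spec.2
      simp only [Set.mem_ofPred_eq, if_pos this]
      split_ifs
      simp
    · rw [if_neg (by simpa using h)]
      split_ifs <;> simp
  have hword : ∀ a a', g a = g a' → word a a' T₁ = word a' a T₂ := by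
    intro a a' h
    funext i
    simp only [word, Protocol.received]
    by_cases h1 : (i : Fin n) ∈ T₁
    · have h2 : (i : Fin n) ∉ T₂ := fun h2 => Finset.disjoint_left.1 hT h1 h2
      rw [if_pos h1, if_neg h2]
      rfl
    · rw [if_neg h1]
      by_cases h2 : (i : Fin n) ∈ T₂
      · rw [if_pos h2]
        rfl
      · rw [if_neg h2]
        exact hg a a' h i h1 h2
  let good : Y → C.Secret × (Fin n → Fin α → F) → Prop :=
    fun y a => g a = y ∧ ¬ bad T₁ a ∧ ¬ bad T₂ a
  -- Guess the secret of any outcome with view `y` that is bad for neither set; all such outcomes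
  -- share one secret. The value `a₀.1` is a filler, and errors occur only on bad outcomes.
  refine ⟨fun y => if h : ∃ a, good y a then h.choose.1 else a₀.1, ?_⟩
  have hsub : ∀ a, (¬ bad T₁ a ∧ ¬ bad T₂ a) →
      a.1 = (if h : ∃ a', good (g a) a' then h.choose.1 else a₀.1) := by
    intro a ha
    have h : ∃ a', good (g a) a' := ⟨a, rfl, ha⟩
    rw [dif_pos h]
    obtain ⟨hc, hc1, -⟩ := h.choose_spec
    generalize h.choose = c at hc hc1
    have e1 : p.decode (word c a T₁) = c.1 := by
      by_contra hne
      exact hc1 ⟨a, hc, hne⟩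
    have e2 : p.decode (word a c T₂) = a.1 := by
      by_contra hne
      exact ha.2 ⟨c, hc.symm, hne⟩
    rw [← e1, ← e2, hword c a hc]
  have := hbad T₁ h₁
  have := hbad T₂ h₂
  rw [toReal_toOuterMeasure_eq_sum] at *
  refine le_trans ?_ (show (∑ a, if a ∈ {a | bad T₁ a} then (C.law a).toReal else 0) +
    (∑ a, if a ∈ {a | bad T₂ a} then (C.law a).toReal else 0) ≤ 2 * ε by linarith)
  rw [← Finset.sum_add_distrib]
  refine Finset.sum_le_sum fun a _ => ?_
  have h0 : 0 ≤ (C.law a).toReal := ENNReal.toReal_nonneg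
  by_cases h1 : bad T₁ a
  · simp only [Set.mem_ofPred_eq, h1, if_true]
    split_ifs <;> linarith
  · by_cases h2 : bad T₂ a
    · simp only [Set.mem_ofPred_eq, h2, if_true]
      split_ifs <;> linarith
    · have := hsub a ⟨h1, h2⟩
      simp only [Set.mem_ofPred_eq]
      rw [if_neg (not_not.2 this), if_neg h1, if_neg h2, add_zero]

/-- In a resilient scheme, at most as many secrets occur as there are `k`-tuples of shares. -/
theorem Scheme.IsResilient.exists_support [Fintype F] (hF : 1 < Fintype.card F)
    {C : Scheme F n α} {k : ℕ} (hk : k ≤ n) (hC : C.IsResilient k) :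
    ∃ supp : Finset C.Secret, (∀ s ∉ supp, (C.law.map Prod.fst s).toReal = 0) ∧
      supp.card ≤ Fintype.card (Fin k → Fin α → F) := by
  classical
  obtain ⟨A, -, hA⟩ := Finset.exists_subset_card_eq (s := (Finset.univ : Finset (Fin n)))
    (n := k) (by simpa using hk)
  have hdet := hC A hA
  let pos : Finset (C.Secret × (Fin n → Fin α → F)) := Finset.univ.filter fun a => C.law a ≠ 0
  refine ⟨pos.image Prod.fst, ?_, ?_⟩
  · intro s hs
    rw [toReal_map_apply]
    refine Finset.sum_eq_zero fun a _ => ?_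
    by_cases h : C.law a = 0
    · simp [h]
    · rw [if_neg]
      rintro rfl
      exact hs (Finset.mem_image_of_mem _ (by simpa [pos] using h))
  · have hcard : Fintype.card (Fin k → Fin α → F) = Fintype.card (A → Fin α → F) := by
      simp [hA]
    rw [hcard]
    have hex : ∀ s ∈ pos.image Prod.fst, ∃ a, C.law a ≠ 0 ∧ a.1 = s := by
      intro s hs
      obtain ⟨a, ha, rfl⟩ := Finset.mem_image.1 hs
      exact ⟨a, by simpa [pos] using ha, rfl⟩
    have : Nonempty (C.Secret × (Fin n → Fin α → F)) := ⟨C.law.support_nonempty.some⟩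
    choose! c hc1 hc2 using hex
    rw [← Finset.card_univ]
    refine Finset.card_le_card_of_injOn (fun s => C.sharesOf A (c s))
      (fun _ _ => Finset.mem_coe.2 (Finset.mem_univ _)) ?_
    intro s hs s' hs' h
    rw [← hc2 s hs, ← hc2 s' hs']
    exact eq_of_condEntropy_eq_zero (by exact_mod_cast hF) C.law _ _ hdet (hc1 s hs)
      (hc1 s' hs') h

/-- The coefficient of the error term in the converse. -/
noncomputable def converseConst (F : Type u) [Fintype F] (k α : ℕ) : ℝ :=
  2 / Real.log (Fintype.card F) * (√(Fintype.card (Fin k → Fin α → F)) * 2)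

/-- Up to an error term, the secret is no larger than the messages of the parties that are neither
malicious in one of two indistinguishable scenarios nor eavesdropped. -/
theorem Protocol.size_le_sum_logb [Fintype F] (hF : 1 < Fintype.card F) {C : Scheme F n α}
    {D : Finset (Fin n)} (p : Protocol C D) {k zr zw : ℕ} {ε : ℝ} (hk : k ≤ n)
    (hpriv : C.IsPrivate zr) (hres : C.IsResilient k) (hp : p.ErrorAtMost zw ε)
    {Z T₁ T₂ : Finset (Fin n)} (G : Finset D) (hT : Disjoint T₁ T₂) (hZ : Z.card = zr)
    (h₁ : T₁.card ≤ zw) (h₂ : T₂.card ≤ zw)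
    (hcover : ∀ i : D, i ∉ G → (i : Fin n) ∉ Z → (i : Fin n) ∉ T₁ → (i : Fin n) ∈ T₂) :
    C.size ≤ ∑ i ∈ G, Real.logb (Fintype.card F) (Fintype.card (p.Msg i)) +
      converseConst F k α * √ε := by
  classical
  have hq : (1 : ℝ) < Fintype.card F := by exact_mod_cast hF
  obtain ⟨a₀, -⟩ := C.law.support_nonempty
  let m : C.Secret × (Fin n → Fin α → F) → ∀ i : G, p.Msg i := fun a i => p.messages a.2 i
  obtain ⟨guess, hguess⟩ := p.exists_guess hp hT h₁ h₂ (fun a => (C.sharesOf Z a, m a)) (by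
    intro a a' h i hi1 hi2
    rw [Prod.mk.injEq] at h
    by_cases hG : i ∈ G
    · exact congrFun h.2 ⟨i, hG⟩
    · have hiZ : (i : Fin n) ∈ Z := by
        by_contra hiZ
        exact hi2 (hcover i hG hiZ hi1)
      have := congrFun h.1 ⟨i, hiZ⟩
      simp only [Scheme.sharesOf] at this
      simp only [Protocol.messages, this])
  obtain ⟨supp, hs1, hs2⟩ := hres.exists_support hF hk
  have hfano := condEntropy_le_sqrt hq C.law Prod.fst (fun a => (C.sharesOf Z a, m a)) guess supp
    hs1 hs2 hguess
  have hcard : Real.logb (Fintype.card F) (Fintype.card (∀ i : G, p.Msg i)) =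
      ∑ i ∈ G, Real.logb (Fintype.card F) (Fintype.card (p.Msg i)) := by
    rw [Fintype.card_pi, Nat.cast_prod, Real.logb_prod _ _ ?_]
    · exact Finset.sum_coe_sort G fun i =>
        Real.logb (Fintype.card F) (Fintype.card (p.Msg i))
    intro i _
    have : 0 < Fintype.card (p.Msg i) := Fintype.card_pos_iff.2 ⟨p.messages a₀.2 i⟩
    exact_mod_cast this.ne'
  have h4 : √(2 * (2 * ε)) = 2 * √ε := by
    rw [show 2 * (2 * ε) = 2 ^ 2 * ε by ring, Real.sqrt_mul (by norm_num),
      Real.sqrt_sq (by norm_num)]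
  calc C.size = condEntropy (Fintype.card F) C.law Prod.fst (C.sharesOf Z) := (hpriv Z hZ).symm
    _ ≤ _ := condEntropy_le_logb_card_add hq C.law Prod.fst (C.sharesOf Z) m
    _ ≤ _ := by
      rw [hcard]
      gcongr
      refine hfano.trans (le_of_eq ?_)
      rw [h4, converseConst]
      ring

theorem converseConst_nonneg [Fintype F] (k α : ℕ) : 0 ≤ converseConst F k α := by
  have : 0 ≤ Real.log (Fintype.card F) := Real.log_natCast_nonneg _
  unfold converseConst
  positivity

theorem exists_pos_mul_sqrt_le {K η : ℝ} (hK : 0 ≤ K) (hη : 0 < η) : ∃ ε > 0, K * √ε ≤ η := by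
  refine ⟨(η / (K + 1)) ^ 2, by positivity, ?_⟩
  rw [Real.sqrt_sq (by positivity), mul_div_assoc', div_le_iff₀ (by positivity)]
  nlinarith

theorem le_omniscientCapacity [Fintype F] (hF : 1 < Fintype.card F) {k zro zwo zrw : ℕ}
    (hkn : k ≤ n) (hzr : zro + zrw < k) {H : ℝ}
    (hH : H ∈ achievableSizes F n k (zro + zrw) (zwo + zrw) α) :
    H ≤ omniscientCapacity k zro zwo zrw α := by
  classical
  refine le_of_forall_pos_le_add fun η hη => ?_
  obtain ⟨ε, hε, hle⟩ := exists_pos_mul_sqrt_le (converseConst_nonneg (F := F) k α) hη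
  obtain ⟨C, ⟨hpriv, hres, hdec⟩, hsize⟩ := hH ε hε
  obtain ⟨A, -, hA⟩ := Finset.exists_subset_card_eq (s := (Finset.univ : Finset (Fin n)))
    (n := k) (by simpa using hkn)
  obtain ⟨dec, hp⟩ := hdec A hA
  obtain ⟨Z, hZA, hZ⟩ := Finset.exists_subset_card_eq (s := A) (n := zro + zrw) (by omega)
  have hAZ := Finset.card_sdiff_of_subset hZA
  -- The minima treat both cases at once: for k ≤ c the sets `T₁`, `T₂` exhaust `A \ Z`, so that `G`
  -- is empty and the bound is 0.
  obtain ⟨T₁, hT₁A, hT₁⟩ := Finset.exists_subset_card_eq (s := A \ Z)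
    (n := min (zwo + zrw) (k - (zro + zrw))) (by omega)
  have hAT₁ := Finset.card_sdiff_of_subset hT₁A
  obtain ⟨T₂, hT₂A, hT₂⟩ := Finset.exists_subset_card_eq (s := (A \ Z) \ T₁)
    (n := min (zwo + zrw) (k - (zro + zrw) - T₁.card)) (by omega)
  have hAT₂ := Finset.card_sdiff_of_subset hT₂A
  have hdisj : Disjoint T₁ T₂ :=
    Finset.disjoint_left.2 fun i h1 h2 => (Finset.mem_sdiff.1 (hT₂A h2)).2 h1
  let G : Finset A := Finset.univ.filter fun i => (i : Fin n) ∈ ((A \ Z) \ T₁) \ T₂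
  have hG : G.card = (((A \ Z) \ T₁) \ T₂).card := by
    rw [← Finset.card_map (Function.Embedding.subtype _)]
    congr 1
    ext i
    simp [G]
    tauto
  have := Protocol.size_le_sum_logb hF _ hkn hpriv hres hp G hdisj hZ (by omega) (by omega) (by
    intro i hi1 hi2 hi3
    by_contra hi4
    exact hi1 (by simp [G, hi2, hi3, hi4]))
  have hlog : ∀ i ∈ G, Real.logb (Fintype.card F)
      (Fintype.card ((C.plainDownload A Finset.univ dec).Msg i)) = α := by
    intro i _
    have : Fintype.card ((C.plainDownload A Finset.univ dec).Msg i) = Fintype.card F ^ α := by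
      show Fintype.card (↥(Finset.univ : Finset (Fin α)) → F) = _
      simp
    rw [this, Nat.cast_pow, Real.logb_pow, Real.logb_self_eq_one (by exact_mod_cast hF), mul_one]
  rw [Finset.sum_congr rfl hlog, Finset.sum_const, nsmul_eq_mul] at this
  have hcap : (G.card : ℝ) * α = omniscientCapacity k zro zwo zrw α := by
    unfold omniscientCapacity
    split_ifs with hc
    · have : k = G.card + (zro + zrw) + 2 * (zwo + zrw) := by omega
      congr 1
      rw [this]
      push_cast
      ring
    · have : G.card = 0 := by omega
      simp [this]
  linarith

/-- The d - c parties with the smallest messages must carry the whole secret up to the error term: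
the other c split into `zr` eavesdropped parties and two groups of `zw` that may imitate each other.
-/
theorem optimalCost_le_of_mem_commCosts [Fintype F] (hF : 1 < Fintype.card F)
    {k zro zwo zrw : ℕ} (hkn : k ≤ n) (hc : 3 * zrw + 2 * zwo + zro < k) {D : Finset (Fin n)}
    (hD : k ≤ D.card) {κ : ℝ}
    (hκ : κ ∈ commCosts F n k (zro + zrw) (zwo + zrw) α (omniscientCapacity k zro zwo zrw α) D) :
    optimalCost k zro zwo zrw α D.card ≤ κ := by
  classical
  set m := D.card - (3 * zrw + 2 * zwo + zro) with hm
  have hmpos : (0 : ℝ) < m := by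
    have : 0 < m := by omega
    exact_mod_cast this
  have hmr : (m : ℝ) = (D.card : ℝ) - 3 * zrw - 2 * zwo - zro := by
    rw [hm, Nat.cast_sub (by omega)]
    push_cast
    ring
  have hd : (0 : ℝ) < D.card := by
    have : 0 < D.card := by omega
    exact_mod_cast this
  have hcap : omniscientCapacity k zro zwo zrw α = ((k : ℝ) - 3 * zrw - 2 * zwo - zro) * α := by
    rw [omniscientCapacity, if_pos hc]
    ring
  rw [optimalCost, ← hmr, ← hcap, div_le_iff₀ hmpos, ← le_div_iff₀' hd]
  refine le_of_forall_pos_le_add fun η hη => ?_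
  obtain ⟨ε, hε, hle⟩ := exists_pos_mul_sqrt_le (converseConst_nonneg (F := F) k α) hη
  obtain ⟨C, ⟨hpriv, hres, -⟩, hsize, p, hp, hcost⟩ := hκ ε hε
  obtain ⟨G, -, hG, hGle⟩ := exists_subset_card_mul_sum_le
    (fun i : D => Real.logb (Fintype.card F) (Fintype.card (p.Msg i))) (m := m) Finset.univ
    (by simp [hm])
  rw [Finset.card_univ, Fintype.card_coe] at hGle
  set G' : Finset (Fin n) := G.map (Function.Embedding.subtype _) with hG'
  have hG'c : G'.card = m := by rw [hG', Finset.card_map, hG]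
  have hG'D : G' ⊆ D := by
    intro i hi
    obtain ⟨j, -, rfl⟩ := Finset.mem_map.1 hi
    exact j.2
  have hDG := Finset.card_sdiff_of_subset hG'D
  obtain ⟨Z, hZA, hZ⟩ := Finset.exists_subset_card_eq (s := D \ G') (n := zro + zrw) (by omega)
  have hAZ := Finset.card_sdiff_of_subset hZA
  obtain ⟨T₁, hT₁A, hT₁⟩ := Finset.exists_subset_card_eq (s := (D \ G') \ Z)
    (n := zwo + zrw) (by omega)
  have hAT₁ := Finset.card_sdiff_of_subset hT₁A
  have := p.size_le_sum_logb hF hkn hpriv hres hp G (T₁ := T₁) (T₂ := ((D \ G') \ Z) \ T₁)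
    Finset.disjoint_sdiff hZ (by omega) (by omega) (by
      intro i hi1 hi2 hi3
      simp [hi1, hi2, hi3, hG'])
  have h2 : ∑ i ∈ G, Real.logb (Fintype.card F) (Fintype.card (p.Msg i)) ≤ κ * m / D.card := by
    rw [le_div_iff₀' hd]
    refine hGle.trans ?_
    rw [mul_comm]
    exact mul_le_mul_of_nonneg_right hcost hmpos.le
  linarith

/-- The protocol in which the contacted parties send all symbols they read. -/
def Protocol.sendAll [Fintype F] {C : Scheme F n α} {D : Finset (Fin n)} (p : Protocol C D) :
    Protocol C D where
  read := p.read
  Msg := fun i => p.read i → F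
  send := fun _ v => v
  decode := fun v => p.decode fun i => p.send i (v i)

theorem Protocol.sendAll_commCost [Fintype F] (hF : 1 < Fintype.card F) {C : Scheme F n α}
    {D : Finset (Fin n)} (p : Protocol C D) : p.sendAll.commCost = p.readCost := by
  refine Finset.sum_congr rfl fun i _ => ?_
  have : Fintype.card (p.sendAll.Msg i) = Fintype.card F ^ (p.read i).card := by
    show Fintype.card (p.read i → F) = _
    simp
  rw [this, Nat.cast_pow, Real.logb_pow, Real.logb_self_eq_one (by exact_mod_cast hF), mul_one]

/-- The decoder applies `send` to whatever arrives, so forged symbols amount to a forged message in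
`p`. Thus bounds on communication are bounds on reading. -/
theorem Protocol.ErrorAtMost.sendAll [Fintype F] {C : Scheme F n α} {D : Finset (Fin n)}
    {p : Protocol C D} {zw : ℕ} {ε : ℝ} (hp : p.ErrorAtMost zw ε) :
    p.sendAll.ErrorAtMost zw ε := by
  intro T hT forge
  have := hp T hT fun a i => p.send i (forge a i)
  convert this using 1
  unfold Protocol.errorProb
  congr 2
  ext a
  have : (fun i => p.send i (p.sendAll.received a.2 T (forge a) i)) =
      p.received a.2 T fun i => p.send i (forge a i) := by
    funext i
    unfold Protocol.received
    split_ifs <;> rfl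
  rw [Set.mem_ofPred_eq, Set.mem_ofPred_eq, ← this]
  rfl

theorem readCosts_subset_commCosts [Fintype F] (hF : 1 < Fintype.card F) (k zr zw : ℕ) (H : ℝ)
    (D : Finset (Fin n)) : readCosts F n k zr zw α H D ⊆ commCosts F n k zr zw α H D := by
  intro κ hκ ε hε
  obtain ⟨C, hC, hsize, p, hp, hcost⟩ := hκ ε hε
  exact ⟨C, hC, hsize, p.sendAll, hp.sendAll, (p.sendAll_commCost hF).trans_le hcost⟩

end Converse

/-! ### Schemes that depend additively on a uniform element of a subgroup. -/

section LinearScheme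

variable {F : Type u} {n α : ℕ} {S : Type u} {V : Type*}

/-- The scheme whose secret and shares are functions of a uniform element of `U`. -/
noncomputable abbrev uniformScheme [Fintype S] (U : Finset V) (hU : U.Nonempty) (sec : V → S)
    (sh : V → Fin n → Fin α → F) : Scheme F n α where
  Secret := S
  law := (PMF.uniformOfFinset U hU).map fun u => (sec u, sh u)

theorem uniformScheme_law_ne_zero [Fintype S] {U : Finset V} {hU : U.Nonempty} {sec : V → S}
    {sh : V → Fin n → Fin α → F} {a : S × (Fin n → Fin α → F)}
    (ha : (uniformScheme U hU sec sh).law a ≠ 0) : ∃ u ∈ U, a = (sec u, sh u) := by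
  have h := (PMF.mem_support_iff _ _).2 ha
  rw [PMF.mem_support_map_iff] at h
  obtain ⟨u, hu, rfl⟩ := h
  exact ⟨u, by simpa using hu, rfl⟩

variable [Field F] [AddCommGroup V] [AddCommGroup S] [Fintype S]

/-- Translation by `u ∈ W` preserves the uniform law and the observation, and moves the secret from
`s` to `s'`. -/
theorem toReal_map_uniformScheme_eq [Fintype V] {Y : Type*} {U : Finset V} {hU : U.Nonempty}
    {W : AddSubgroup V} (hW : ∀ u, u ∈ U ↔ u ∈ W) {sec : V →+ S}
    {sh : V →+ (Fin n → Fin α → F)} (g : (Fin n → Fin α → F) → Y)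
    (hfill : ∀ s : S, ∃ u ∈ W, sec u = s ∧ ∀ v, g (sh (v + u)) = g (sh v)) (s s' : S) (y : Y) :
    ((uniformScheme U hU sec sh).law.map (fun a => (a.1, g a.2)) (s, y)).toReal =
      ((uniformScheme U hU sec sh).law.map (fun a => (a.1, g a.2)) (s', y)).toReal := by
  classical
  obtain ⟨u, hu, hs, hg⟩ := hfill (s' - s)
  rw [PMF.map_comp, toReal_map_apply, toReal_map_apply]
  refine Fintype.sum_equiv (Equiv.addRight u) _ _ fun v => ?_
  have h1 : v + u ∈ U ↔ v ∈ U := by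
    rw [hW, hW]
    exact W.add_mem_cancel_right hu
  simp only [Function.comp, Prod.mk.injEq, Equiv.coe_addRight, map_add sec, hs, hg,
    PMF.uniformOfFinset_apply, h1, ← eq_sub_iff_add_eq, sub_sub_cancel]

variable [Fintype F]

theorem uniformScheme_isPrivate [Fintype V] {U : Finset V} {hU : U.Nonempty}
    {W : AddSubgroup V} (hW : ∀ u, u ∈ U ↔ u ∈ W) {sec : V →+ S}
    {sh : V →+ (Fin n → Fin α → F)} {zr : ℕ}
    (hfill : ∀ Z : Finset (Fin n), Z.card = zr → ∀ s : S,
      ∃ u ∈ W, sec u = s ∧ ∀ i ∈ Z, sh u i = 0) (hzr : zr ≤ n) :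
    (uniformScheme U hU sec sh).IsPrivate zr ∧
      (uniformScheme U hU sec sh).size = Real.logb (Fintype.card F) (Fintype.card S) := by
  classical
  have hsize : ∀ b : ℝ, entropy b (uniformScheme U hU sec sh).law Prod.fst =
      Real.logb b (Fintype.card S) := by
    intro b
    refine entropy_eq_logb_card b _ _ fun s s' => ?_
    -- Any `Z` will do: with a trivial observation only surjectivity of `sec` on `W` matters.
    obtain ⟨Z, -, hZ⟩ := Finset.exists_subset_card_eq (s := (Finset.univ : Finset (Fin n)))
      (n := zr) (by simpa using hzr)
    have h := toReal_map_uniformScheme_eq (hU := hU) hW (sec := sec) (sh := sh) (fun _ => ())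
      (fun s => by
        obtain ⟨u, hu, hs, -⟩ := hfill Z hZ s
        exact ⟨u, hu, hs, fun _ => rfl⟩) s s' ()
    have e := fun s => sum_toReal_map_pair_right (uniformScheme U hU sec sh).law
      Prod.fst (fun _ => ()) s
    simp only [Finset.univ_unique, Finset.sum_singleton] at e
    rw [← e, ← e]
    exact h
  refine ⟨fun Z hZ => ?_, hsize _⟩
  rw [hsize]
  refine condEntropy_eq_logb_card _ _ _ _ fun s s' y => ?_
  refine toReal_map_uniformScheme_eq (hU := hU) hW (sec := sec) (sh := sh)
    (fun w (i : Z) => w i) (fun s => ?_) s s' y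
  obtain ⟨u, hu, hs, h0⟩ := hfill Z hZ s
  refine ⟨u, hu, hs, fun v => ?_⟩
  funext i
  rw [map_add, Pi.add_apply, h0 i i.2, add_zero]

theorem uniformScheme_isResilient {U : Finset V} {hU : U.Nonempty}
    {W : AddSubgroup V} (hW : ∀ u, u ∈ U ↔ u ∈ W) {sec : V →+ S}
    {sh : V →+ (Fin n → Fin α → F)} {k : ℕ}
    (hvan : ∀ A : Finset (Fin n), A.card = k → ∀ u ∈ W, (∀ i ∈ A, sh u i = 0) → sec u = 0) :
    (uniformScheme U hU sec sh).IsResilient k := by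
  classical
  intro A hA
  refine condEntropy_eq_zero _ _ _ _ fun a a' ha ha' h => ?_
  obtain ⟨u, hu, rfl⟩ := uniformScheme_law_ne_zero ha
  obtain ⟨u', hu', rfl⟩ := uniformScheme_law_ne_zero ha'
  rw [hW] at hu hu'
  refine (sub_eq_zero (G := S)).1 ?_
  rw [← map_sub]
  refine hvan A hA _ (W.sub_mem hu hu') fun i hi => ?_
  rw [map_sub, Pi.sub_apply, sub_eq_zero]
  exact congrFun h ⟨i, hi⟩

/-- A user that can tell any two different secrets apart in spite of `2 zw` erasures can correct
`zw` errors. -/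
theorem exists_decode_uniformScheme {U : Finset V} {hU : U.Nonempty}
    {W : AddSubgroup V} (hW : ∀ u, u ∈ U ↔ u ∈ W) {sec : V →+ S}
    {sh : V →+ (Fin n → Fin α → F)} {zw : ℕ} (D : Finset (Fin n)) (R : Finset (Fin α))
    (hvan : ∀ E ⊆ D, D.card ≤ E.card + 2 * zw →
      ∀ u ∈ W, (∀ i ∈ E, ∀ c ∈ R, sh u i c = 0) → sec u = 0) :
    ∃ dec, ((uniformScheme U hU sec sh).plainDownload D R dec).ErrorAtMost zw 0 := by
  classical
  -- Decode to any codeword compatible with at most `zw` liars. It agrees with the true one outside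
  -- `T ∪ T'`, that is, on all but `2 zw` contacted parties, so the difference has secret zero. The
  -- default 0 is never used on words that can be received.
  let explains : (D → R → F) → V → Prop := fun y u =>
    u ∈ W ∧ ∃ T : Finset (Fin n), T.card ≤ zw ∧ ∀ i : D, (i : Fin n) ∉ T → ∀ c : R,
      sh u i c = y i c
  let dec : (D → R → F) → S := fun y =>
    if h : ∃ u, explains y u then sec h.choose else 0
  refine ⟨dec, fun T hT forge => ?_⟩
  refine le_of_eq ?_
  rw [Protocol.errorProb, ENNReal.toReal_eq_zero_iff]
  left
  rw [PMF.toOuterMeasure_apply_eq_zero_iff, Set.disjoint_left]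
  intro a ha
  obtain ⟨u, hu, rfl⟩ := uniformScheme_law_ne_zero ((PMF.mem_support_iff _ _).1 ha)
  rw [hW] at hu
  rw [Set.mem_ofPred_eq, not_not]
  set y : D → R → F := Protocol.received
    ((uniformScheme U hU sec sh).plainDownload D R dec) (sh u) T (forge (sec u, sh u)) with hy
  have hex : ∃ u, explains y u := by
    refine ⟨u, hu, T, hT, fun i hi c => ?_⟩
    simp only [hy, Protocol.received, if_neg hi]
    rfl
  show dec y = sec u
  simp only [dec, dif_pos hex]
  obtain ⟨hu', T', hT', h'⟩ := hex.choose_spec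
  generalize hex.choose = u' at hu' h'
  refine sub_eq_zero.1 ?_
  rw [← map_sub]
  refine hvan (D \ (T ∪ T')) Finset.sdiff_subset ?_ _ (W.sub_mem hu' hu) ?_
  · have h1 := Finset.card_union_le T T'
    have h2 := Finset.le_card_sdiff (T ∪ T') D
    omega
  · intro i hi c hc
    simp only [Finset.mem_sdiff, Finset.mem_union, not_or] at hi
    have h1 := h' ⟨i, hi.1⟩ hi.2.2 ⟨c, hc⟩
    simp only [hy, Protocol.received, if_neg hi.2.1] at h1
    rw [map_sub, Pi.sub_apply, Pi.sub_apply, sub_eq_zero]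
    exact h1

end LinearScheme

/-! ### Block widths, layouts and interpolation. -/

section Staircase

variable {F : Type u} {t z N α : ℕ}

theorem stairWidth_self (hz : z < t) : stairWidth t z α t = α :=
  Nat.mul_div_cancel_left α (by omega)

theorem stairWidth_anti (hz : z < t) {e e' : ℕ} (he : t ≤ e) (h : e ≤ e') :
    stairWidth t z α e' ≤ stairWidth t z α e :=
  Nat.div_le_div_left (by omega) (by omega)

theorem stairWidth_le (hz : z < t) {e : ℕ} (he : t ≤ e) : stairWidth t z α e ≤ α :=
  (stairWidth_anti hz le_rfl he).trans (stairWidth_self hz).le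

theorem sub_mul_stairWidth {e : ℕ} (h : (e - z) ∣ (t - z) * α) :
    (e - z) * stairWidth t z α e = (t - z) * α :=
  Nat.mul_div_cancel' h

/-- Both (e - z)α_e and (e + 1 - z)α_{e+1} equal (t - z)α. Hence the data cells of `M_e` are exactly
as many as the entries of the row copied into them. -/
theorem sub_mul_stairWidth_sub (hz : z < t) {e : ℕ} (he : t ≤ e) (h : (e - z) ∣ (t - z) * α)
    (h' : (e + 1 - z) ∣ (t - z) * α) :
    (e - z) * (stairWidth t z α e - stairWidth t z α (e + 1)) = stairWidth t z α (e + 1) := by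
  rw [Nat.mul_sub, sub_mul_stairWidth h, ← sub_mul_stairWidth h',
    show e + 1 - z = (e - z) + 1 by omega, add_one_mul, Nat.add_sub_cancel_left]

/-- Every column after those of `M_N` belongs to some block `M_e` with `e < N`. -/
theorem exists_block (hz : z < t) {c : ℕ} (hc : c < α) :
    ∀ N, t ≤ N → stairWidth t z α N ≤ c →
      ∃ e, t ≤ e ∧ e < N ∧ stairWidth t z α (e + 1) ≤ c ∧ c < stairWidth t z α e := by
  intro N hN
  induction N, hN using Nat.le_induction with
  | base => intro h; rw [stairWidth_self hz] at h; omega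
  | succ N hN ih =>
    intro h
    by_cases h' : stairWidth t z α N ≤ c
    · obtain ⟨e, h1, h2, h3⟩ := ih h'
      exact ⟨e, h1, by omega, h3⟩
    · exact ⟨N, hN, by omega, h, by omega⟩

/-- A variant of `IsStaircaseMatrix` in which the data of each block are placed in the rows given
by `ρ`. -/
structure IsStaircaseLayout [Zero F] (ρ : Fin N → Fin N) (t z : ℕ)
    (M : Matrix (Fin N) (Fin α) F) : Prop where
  copy : ∀ (e r : Fin N) (c l : Fin α), t ≤ (e : ℕ) →
    stairWidth t z α (e + 1) ≤ (c : ℕ) → (c : ℕ) < stairWidth t z α e → (r : ℕ) + z < e →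
    (l : ℕ) = r * (stairWidth t z α e - stairWidth t z α (e + 1)) +
      (c - stairWidth t z α (e + 1)) →
    M (ρ r) c = M e l
  zero : ∀ (e r : Fin N) (c : Fin α), t ≤ (e : ℕ) →
    stairWidth t z α (e + 1) ≤ (c : ℕ) → (c : ℕ) < stairWidth t z α e → (e : ℕ) ≤ r →
    M r c = 0

theorem isStaircaseMatrix_iff [Zero F] {M : Matrix (Fin N) (Fin α) F} :
    IsStaircaseMatrix t z N α M ↔ IsStaircaseLayout id t z M :=
  ⟨fun h => ⟨h.copy, h.zero⟩, fun h => ⟨h.copy, h.zero⟩⟩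

section Field

variable [Field F]

/-- The message matrices with a given layout. -/
def layoutSubgroup (F : Type u) [Field F] (ρ : Fin N → Fin N) (t z α : ℕ) :
    AddSubgroup (Matrix (Fin N) (Fin α) F) where
  carrier := {M | IsStaircaseLayout ρ t z M}
  zero_mem' := ⟨fun _ _ _ _ _ _ _ _ _ => rfl, fun _ _ _ _ _ _ _ => rfl⟩
  add_mem' := fun {A B} hA hB =>
    ⟨fun e r c l h1 h2 h3 h4 h5 => by
      rw [Matrix.add_apply, Matrix.add_apply, hA.copy e r c l h1 h2 h3 h4 h5,
        hB.copy e r c l h1 h2 h3 h4 h5],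
    fun e r c h1 h2 h3 h4 => by
      rw [Matrix.add_apply, hA.zero e r c h1 h2 h3 h4, hB.zero e r c h1 h2 h3 h4, add_zero]⟩
  neg_mem' := fun {A} hA =>
    ⟨fun e r c l h1 h2 h3 h4 h5 => by
      rw [Matrix.neg_apply, Matrix.neg_apply, hA.copy e r c l h1 h2 h3 h4 h5],
    fun e r c h1 h2 h3 h4 => by
      rw [Matrix.neg_apply, hA.zero e r c h1 h2 h3 h4, neg_zero]⟩

theorem mem_layoutSubgroup {ρ : Fin N → Fin N} {M : Matrix (Fin N) (Fin α) F} :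
    M ∈ layoutSubgroup F ρ t z α ↔ IsStaircaseLayout ρ t z M := Iff.rfl

/-- A polynomial that vanishes at more points than its degree is zero. -/
theorem eq_zero_of_sum_pow_mul_eq_zero {n : ℕ} {x : Fin n → F} (hx : Function.Injective x)
    {E : Finset (Fin n)} {v : Fin N → F} (hv : ∀ r : Fin N, E.card ≤ (r : ℕ) → v r = 0)
    (h : ∀ i ∈ E, ∑ r : Fin N, x i ^ (r : ℕ) * v r = 0) : v = 0 := by
  classical
  let p : Polynomial F := ∑ r : Fin N, Polynomial.monomial (r : ℕ) (v r)
  have hcoeff : ∀ r : Fin N, p.coeff r = v r := by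
    intro r
    simp only [p, Polynomial.finsetSum_coeff, Polynomial.coeff_monomial, Fin.val_inj]
    simp
  have hp : p = 0 := by
    refine Polynomial.eq_zero_of_degree_lt_of_eval_index_eq_zero (v := x) (s := E) hx.injOn ?_ ?_
    · rw [Polynomial.degree_lt_iff_coeff_zero]
      intro m hm
      simp only [p, Polynomial.finsetSum_coeff, Polynomial.coeff_monomial]
      refine Finset.sum_eq_zero fun r _ => ?_
      split_ifs with hr
      · exact hv r (hr ▸ hm)
      · rfl
    · intro i hi
      rw [← h i hi]
      simp only [p, Polynomial.eval_finsetSum, Polynomial.eval_monomial]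
      exact Finset.sum_congr rfl fun r _ => mul_comm _ _
  funext r
  rw [← hcoeff, hp, Polynomial.coeff_zero, Pi.zero_apply]

/-- A column can be completed, by its entries in `Z.card` consecutive rows, to one that encodes to
zero at the parties in `Z`. -/
theorem exists_completion {n : ℕ} {x : Fin n → F} (hx : Function.Injective x)
    (Z : Finset (Fin n)) {o : ℕ} (ho : o + Z.card ≤ N) (hx0 : o = 0 ∨ ∀ i, x i ≠ 0)
    (b : Fin N → F) :
    ∃ v : Fin N → F, (∀ r : Fin N, (r : ℕ) < o ∨ o + Z.card ≤ r → v r = b r) ∧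
      ∀ i ∈ Z, ∑ r : Fin N, x i ^ (r : ℕ) * v r = 0 := by
  classical
  let b' : Fin N → F := fun r => if (r : ℕ) < o ∨ o + Z.card ≤ r then b r else 0
  -- The free rows contribute x^o g(x), which must cancel the fixed rows at the points of `Z`;
  -- dividing by x^o is why nonzero points are needed when `o ≠ 0`.
  let g : Polynomial F := Lagrange.interpolate Z x fun i =>
    -(∑ r : Fin N, x i ^ (r : ℕ) * b' r) / x i ^ o
  refine ⟨fun r => if (r : ℕ) < o ∨ o + Z.card ≤ r then b r else g.coeff (r - o),
    fun r hr => if_pos hr, fun i hi => ?_⟩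
  have hpow : x i ^ o ≠ 0 := by
    rcases hx0 with rfl | h
    · simp
    · exact pow_ne_zero _ (h i)
  have hg : g.eval (x i) = -(∑ r : Fin N, x i ^ (r : ℕ) * b' r) / x i ^ o :=
    Lagrange.eval_interpolate_at_node _ hx.injOn hi
  have hdeg : g.degree < Z.card := Lagrange.degree_interpolate_lt _ hx.injOn
  have hgsum : x i ^ o * g.eval (x i) =
      ∑ r : Fin N, x i ^ (r : ℕ) *
        (if (r : ℕ) < o ∨ o + Z.card ≤ r then 0 else g.coeff (r - o)) := by
    by_cases hg0 : g = 0
    · simp [hg0]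
    have h1 : (Polynomial.X ^ o * g).natDegree < N := by
      have h2 := (Polynomial.natDegree_lt_iff_degree_lt hg0).2 hdeg
      have h3 := Polynomial.natDegree_mul_le (p := (Polynomial.X : Polynomial F) ^ o) (q := g)
      rw [Polynomial.natDegree_X_pow] at h3
      omega
    have h2 := Polynomial.eval_eq_sum_range' h1 (x i)
    rw [Polynomial.eval_mul, Polynomial.eval_pow, Polynomial.eval_X] at h2
    rw [h2, Finset.sum_range]
    refine Finset.sum_congr rfl fun r _ => ?_
    rw [Polynomial.coeff_X_pow_mul', mul_comm]
    congr 1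
    by_cases h3 : (r : ℕ) < o
    · rw [if_pos (Or.inl h3), if_neg (by omega)]
    · rw [if_pos (by omega)]
      split_ifs with h4
      · refine Polynomial.coeff_eq_zero_of_degree_lt (hdeg.trans_le ?_)
        have : Z.card ≤ (r : ℕ) - o := by omega
        exact_mod_cast this
      · rfl
  have hsplit : ∀ r : Fin N, (if (r : ℕ) < o ∨ o + Z.card ≤ r then b r else g.coeff (r - o)) =
      b' r + if (r : ℕ) < o ∨ o + Z.card ≤ r then 0 else g.coeff (r - o) := by
    intro r
    simp only [b']
    split_ifs <;> simp
  simp only [hsplit, mul_add, Finset.sum_add_distrib]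
  rw [← hgsum, hg, mul_div_cancel₀ _ hpow, add_neg_cancel]

end Field

end Staircase

/-! ### Peeling and filling of Staircase matrices. -/

section StaircaseCode

variable {F : Type u} [Field F] {n t z N α : ℕ}

/-- The copied row of the preceding blocks lies to the left of the block it is copied to. -/
theorem stairWidth_source_lt (hz : z < t) (hdiv : ∀ e, t ≤ e → e ≤ N → (e - z) ∣ (t - z) * α)
    {e r c : ℕ} (he : t ≤ e) (heN : e < N) (hc' : c < stairWidth t z α e)
    (hc : stairWidth t z α (e + 1) ≤ c) (hr : r + z < e) :
    r * (stairWidth t z α e - stairWidth t z α (e + 1)) + (c - stairWidth t z α (e + 1)) <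
      stairWidth t z α (e + 1) := by
  have h := sub_mul_stairWidth_sub hz he (hdiv e he heN.le) (hdiv (e + 1) (by omega) heN)
  have h2 : (r + 1) * (stairWidth t z α e - stairWidth t z α (e + 1)) ≤
      (e - z) * (stairWidth t z α e - stairWidth t z α (e + 1)) :=
    Nat.mul_le_mul_right _ (by omega)
  rw [add_one_mul] at h2
  omega

/-- The blocks that `E.card` parties download vanish if their encodings do. -/
theorem IsStaircaseLayout.eq_zero {ρ : Fin N → Fin N} (hz : z < t)
    (hdiv : ∀ e, t ≤ e → e ≤ N → (e - z) ∣ (t - z) * α) {x : Fin n → F}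
    (hx : Function.Injective x) {E : Finset (Fin n)} (hE : t ≤ E.card)
    {M : Matrix (Fin N) (Fin α) F} (hM : IsStaircaseLayout ρ t z M)
    (h : ∀ i ∈ E, ∀ c : Fin α, (c : ℕ) < stairWidth t z α E.card →
      ∑ r : Fin N, x i ^ (r : ℕ) * M r c = 0) (e : ℕ) (hEe : E.card ≤ e) (heN : e ≤ N)
    (c : Fin α) (hc : (c : ℕ) < stairWidth t z α e)
    (hc' : e < N → stairWidth t z α (e + 1) ≤ c) (r : Fin N) : M r c = 0 := by
  induction e using Nat.strong_induction_on generalizing c r with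
  | _ e ih =>
  suffices hcol : (fun r => M r c) = 0 from congrFun hcol r
  refine eq_zero_of_sum_pow_mul_eq_zero hx (E := E) (fun r hr => ?_)
    (fun i hi => h i hi c (hc.trans_le (stairWidth_anti hz hE hEe)))
  -- Rows from `e` on are zero by the layout. A row `r` with `E.card ≤ r < e` was copied into block
  -- `M_r`, which vanishes by induction. Only degrees below `E.card` remain.
  rcases le_or_gt e (r : ℕ) with her | her
  · have heN' : e < N := her.trans_lt r.2
    exact hM.zero ⟨e, heN'⟩ r c (hE.trans hEe) (hc' heN') hc her
  · have htr : t ≤ (r : ℕ) := hE.trans hr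
    have hw := sub_mul_stairWidth_sub hz htr (hdiv r htr r.2.le)
      (hdiv (r + 1) (by omega) (by omega))
    set w := stairWidth t z α r - stairWidth t z α (r + 1) with hwdef
    have hcr : (c : ℕ) < stairWidth t z α (r + 1) :=
      hc.trans_le (stairWidth_anti hz (by omega) her)
    have hwpos : 0 < w := by
      rcases Nat.eq_zero_or_pos w with h0 | h0
      · rw [h0, mul_zero] at hw
        omega
      · exact h0
    have hdivlt : (c : ℕ) / w < r - z := by
      rw [Nat.div_lt_iff_lt_mul hwpos, hw]
      exact hcr
    have hmod : (c : ℕ) % w < w := Nat.mod_lt _ hwpos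
    have hle : stairWidth t z α r ≤ α := stairWidth_le hz htr
    -- Quotient and remainder by the width `w` of `M_r` invert the wrapping: they locate the cell
    -- that holds the copy of entry `c` of row `r`.
    have hcopy := hM.copy r ⟨(c : ℕ) / w, by omega⟩
      ⟨stairWidth t z α (r + 1) + (c : ℕ) % w, by omega⟩ c htr (by simp)
      (show stairWidth t z α (r + 1) + (c : ℕ) % w < _ by omega)
      (show (c : ℕ) / w + z < r by omega) (by
        simp only [Nat.add_sub_cancel_left]
        rw [← hwdef, mul_comm, Nat.div_add_mod])
    rw [← hcopy]
    exact ih r her hr r.2.le _ (show stairWidth t z α (r + 1) + (c : ℕ) % w < _ by omega)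
      (fun _ => by simp) _

/-- Each column of each block can be completed, by its random entries, to one that encodes to zero
at the parties in `Z`. -/
def Completable (ρ : Fin N → Fin N) (x : Fin n → F) (t z : ℕ) (Z : Finset (Fin n)) : Prop :=
  ∀ e, t ≤ e → e ≤ N → ∀ data : Fin N → F, ∃ v : Fin N → F,
    (∀ r : Fin N, (r : ℕ) + z < e → v (ρ r) = data r) ∧ (∀ r : Fin N, e ≤ r → v r = 0) ∧
      ∀ i ∈ Z, ∑ r : Fin N, x i ^ (r : ℕ) * v r = 0

/-- The random rows are e - z, …, e - 1, above which the data have lower degrees, so the interpolant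
carries the factor x^(e - z). -/
theorem completable_id {x : Fin n → F} (hx : Function.Injective x) (hx0 : ∀ i, x i ≠ 0)
    (hz : z < t) {Z : Finset (Fin n)} (hZ : Z.card = z) :
    Completable (N := N) id x t z Z := by
  intro e he heN data
  obtain ⟨v, hv, hv'⟩ := exists_completion (N := N) hx Z (o := e - z) (by omega) (Or.inr hx0)
    fun r => if (r : ℕ) + z < e then data r else 0
  refine ⟨v, fun r hr => ?_, fun r hr => ?_, hv'⟩
  · rw [id, hv r (by omega), if_pos hr]
  · rw [hv r (by omega), if_neg (by omega)]

/-- The shift of the rows by `z`. -/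
def shiftRows (N z : ℕ) (r : Fin N) : Fin N :=
  if h : (r : ℕ) + z < N then ⟨r + z, h⟩ else r

/-- The random rows are now 0, …, z - 1, so no power of x has to be inverted and 0 is allowed as a
point. The branch of `shiftRows` that leaves `r` fixed is not reached, as data rows satisfy r + z <
e ≤ N. -/
theorem completable_shiftRows {x : Fin n → F} (hx : Function.Injective x)
    (hz : z < t) {Z : Finset (Fin n)} (hZ : Z.card = z) :
    Completable (shiftRows N z) x t z Z := by
  intro e he heN data
  obtain ⟨v, hv, hv'⟩ := exists_completion (N := N) hx Z (o := 0) (by omega) (Or.inl rfl)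
    fun r => if (r : ℕ) < e then data ⟨r - z, by omega⟩ else 0
  refine ⟨v, fun r hr => ?_, fun r hr => ?_, hv'⟩
  · have hrN : (r : ℕ) + z < N := by omega
    rw [shiftRows, dif_pos hrN, hv _ (Or.inr (by simp [hZ])), if_pos hr]
    congr 1
    ext
    simp
  · rw [hv r (by omega), if_neg (by omega)]

/-- Every secret is encoded by some message matrix whose shares vanish at the parties in `Z`. -/
theorem exists_layout {ρ : Fin N → Fin N} (hz : z < t) (htN : t ≤ N)
    (hdiv : ∀ e, t ≤ e → e ≤ N → (e - z) ∣ (t - z) * α) {x : Fin n → F} {Z : Finset (Fin n)}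
    (hZ : Completable ρ x t z Z) (s : Fin N → Fin α → F) :
    ∃ M : Matrix (Fin N) (Fin α) F, IsStaircaseLayout ρ t z M ∧
      (∀ (r : Fin N) (c : Fin α), (r : ℕ) + z < N → (c : ℕ) < stairWidth t z α N →
        M (ρ r) c = s r c) ∧ ∀ i ∈ Z, ∀ c, ∑ r : Fin N, x i ^ (r : ℕ) * M r c = 0 := by
  -- The matrix is filled column by column from the left: the data of a column are secret symbols or
  -- entries of earlier columns, and its random entries make the shares in `Z` vanish.
  suffices H : ∀ m, m ≤ α → ∃ M : Matrix (Fin N) (Fin α) F,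
      (∀ c : Fin α, (c : ℕ) < m → (∀ (e r : Fin N) (l : Fin α), t ≤ (e : ℕ) →
        stairWidth t z α (e + 1) ≤ (c : ℕ) → (c : ℕ) < stairWidth t z α e → (r : ℕ) + z < e →
        (l : ℕ) = r * (stairWidth t z α e - stairWidth t z α (e + 1)) +
          (c - stairWidth t z α (e + 1)) → M (ρ r) c = M e l) ∧
        (∀ (e r : Fin N), t ≤ (e : ℕ) → stairWidth t z α (e + 1) ≤ (c : ℕ) →
          (c : ℕ) < stairWidth t z α e → (e : ℕ) ≤ r → M r c = 0) ∧
        (∀ r : Fin N, (r : ℕ) + z < N → (c : ℕ) < stairWidth t z α N → M (ρ r) c = s r c) ∧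
        ∀ i ∈ Z, ∑ r : Fin N, x i ^ (r : ℕ) * M r c = 0) by
    obtain ⟨M, hM⟩ := H α le_rfl
    exact ⟨M, ⟨fun e r c l => (hM c c.2).1 e r l, fun e r c => (hM c c.2).2.1 e r⟩,
      fun r c => (hM c c.2).2.2.1 r, fun i hi c => (hM c c.2).2.2.2 i hi⟩
  intro m
  induction m with
  | zero => exact fun _ => ⟨0, fun c hc => absurd hc (by omega)⟩
  | succ m ih =>
    intro hm
    obtain ⟨M, hM⟩ := ih (by omega)
    have hcol : ∃ v : Fin N → F, (∀ (e r : Fin N) (l : Fin α), t ≤ (e : ℕ) →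
        stairWidth t z α (e + 1) ≤ m → m < stairWidth t z α e → (r : ℕ) + z < e →
        (l : ℕ) = r * (stairWidth t z α e - stairWidth t z α (e + 1)) +
          (m - stairWidth t z α (e + 1)) → v (ρ r) = M e l) ∧
        (∀ (e r : Fin N), t ≤ (e : ℕ) → stairWidth t z α (e + 1) ≤ m →
          m < stairWidth t z α e → (e : ℕ) ≤ r → v r = 0) ∧
        (∀ r : Fin N, (r : ℕ) + z < N → m < stairWidth t z α N → v (ρ r) = s r ⟨m, hm⟩) ∧
        ∀ i ∈ Z, ∑ r : Fin N, x i ^ (r : ℕ) * v r = 0 := by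
      rcases lt_or_ge m (stairWidth t z α N) with hmN | hmN
      · have hno : ∀ e : Fin N, t ≤ (e : ℕ) → ¬ stairWidth t z α (e + 1) ≤ m := by
          intro e he h
          have := stairWidth_anti (α := α) hz (show t ≤ (e : ℕ) + 1 by omega) e.2
          omega
        obtain ⟨v, hv1, -, hv3⟩ := hZ N htN le_rfl fun r => s r ⟨m, hm⟩
        exact ⟨v, fun e r l h1 h2 => absurd h2 (hno e h1), fun e r h1 h2 => absurd h2 (hno e h1),
          fun r hr _ => hv1 r hr, hv3⟩
      · obtain ⟨e, he, heN, h1, h2⟩ := exists_block hz hm N htN hmN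
        have huniq : ∀ e' : Fin N, t ≤ (e' : ℕ) → stairWidth t z α (e' + 1) ≤ m →
            m < stairWidth t z α e' → e' = ⟨e, heN⟩ := by
          intro e' he' h1' h2'
          ext
          by_contra hne
          rcases lt_or_gt_of_ne hne with hlt | hlt
          · have := stairWidth_anti (α := α) hz (show t ≤ (e' : ℕ) + 1 by omega) hlt
            simp only at this
            omega
          · have := stairWidth_anti (α := α) hz (show t ≤ e + 1 by omega) hlt
            omega
        -- The data are read off row `e` by wrapping; the value 0 occurs only at rows that are not
        -- data rows.
        obtain ⟨v, hv1, hv2, hv3⟩ := hZ e he heN.le fun r =>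
          if hl : (r : ℕ) * (stairWidth t z α e - stairWidth t z α (e + 1)) +
            (m - stairWidth t z α (e + 1)) < α then M ⟨e, heN⟩ ⟨_, hl⟩ else 0
        refine ⟨v, fun e' r l h3 h4 h5 h6 h7 => ?_, fun e' r h3 h4 h5 h6 => ?_,
          fun r _ h => absurd h (by omega), hv3⟩
        · obtain rfl := huniq e' h3 h4 h5
          simp only at h6 h7
          rw [hv1 r h6, dif_pos (h7 ▸ l.2)]
          congr 1
          exact Fin.ext h7.symm
        · obtain rfl := huniq e' h3 h4 h5
          exact hv2 r h6
    obtain ⟨v, hv1, hv2, hv3, hv4⟩ := hcol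
    refine ⟨fun r c => if (c : ℕ) = m then v r else M r c, fun c hc => ?_⟩
    rcases Nat.lt_succ_iff_lt_or_eq.1 hc with hcm | rfl
    · simp only [if_neg hcm.ne]
      refine ⟨fun e r l h1 h2 h3 h4 h5 => ?_, (hM c hcm).2⟩
      -- The source column lies strictly left of the block, so inserting column `m` does not alter
      -- it.
      have := stairWidth_source_lt hz hdiv h1 e.2 h3 h2 h4
      rw [if_neg (by omega)]
      exact (hM c hcm).1 e r l h1 h2 h3 h4 h5
    · simp only [if_true]
      refine ⟨fun e r l h1 h2 h3 h4 h5 => ?_, hv2, hv3, hv4⟩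
      have := stairWidth_source_lt hz hdiv h1 e.2 h3 h2 h4
      rw [if_neg (by omega)]
      exact hv1 e r l h1 h2 h3 h4 h5

/-- The secret symbols in a message matrix. -/
def layoutSecret (ρ : Fin N → Fin N) (t z α : ℕ) : Matrix (Fin N) (Fin α) F →+
    ({p : Fin N × Fin α // (p.1 : ℕ) + z < N ∧ (p.2 : ℕ) < stairWidth t z α N} → F) where
  toFun M := fun p => M (ρ p.1.1) p.1.2
  map_zero' := rfl
  map_add' _ _ := rfl

/-- The shares computed from a message matrix. -/
def layoutShares (x : Fin n → F) (N α : ℕ) :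
    Matrix (Fin N) (Fin α) F →+ (Fin n → Fin α → F) where
  toFun M := fun i c => ∑ r : Fin N, x i ^ (r : ℕ) * M r c
  map_zero' := by
    funext i c
    simp
  map_add' A B := by
    funext i c
    simp [mul_add, Finset.sum_add_distrib]

theorem card_layoutSecret_index (hz : z < t) (htN : t ≤ N) :
    Fintype.card {p : Fin N × Fin α // (p.1 : ℕ) + z < N ∧ (p.2 : ℕ) < stairWidth t z α N} =
      (N - z) * stairWidth t z α N := by
  have h1 : stairWidth t z α N ≤ α := stairWidth_le hz htN
  let e : {p : Fin N × Fin α // (p.1 : ℕ) + z < N ∧ (p.2 : ℕ) < stairWidth t z α N} ≃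
      Fin (N - z) × Fin (stairWidth t z α N) :=
    { toFun := fun p => (⟨p.1.1, by have := p.2.1; omega⟩, ⟨p.1.2, p.2.2⟩)
      invFun := fun p => ⟨(⟨p.1, by omega⟩, ⟨p.2, by omega⟩), by simp only; omega, p.2.2⟩
      left_inv := fun p => rfl
      right_inv := fun p => rfl }
  rw [Fintype.card_congr e]
  simp

variable [Fintype F]

theorem staircaseCode_eq_uniformScheme (x : Fin n → F) (t z N α : ℕ) :
    ∃ (U : Finset (Matrix (Fin N) (Fin α) F)) (hU : U.Nonempty),
      (∀ M, M ∈ U ↔ M ∈ layoutSubgroup F id t z α) ∧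
      staircaseCode x t z N α = uniformScheme U hU (layoutSecret id t z α)
        (layoutShares x N α) := by
  classical
  exact ⟨_, _, fun M => by
    rw [Finset.mem_filter, mem_layoutSubgroup, isStaircaseMatrix_iff]; simp, rfl⟩

end StaircaseCode

/-! ### Optimality of the codes. -/

section Optimal

theorem Protocol.ErrorAtMost.mono {F : Type u} {n α : ℕ} {C : Scheme F n α}
    {D : Finset (Fin n)} {p : Protocol C D} {zw : ℕ} {ε ε' : ℝ} (hp : p.ErrorAtMost zw ε)
    (h : ε ≤ ε') : p.ErrorAtMost zw ε' :=
  fun T hT forge => (hp T hT forge).trans h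

theorem Scheme.IsReliable.mono {F : Type u} [Fintype F] {n α k zr zw : ℕ} {C : Scheme F n α}
    {ε ε' : ℝ} (hC : C.IsReliable k zr zw ε) (h : ε ≤ ε') : C.IsReliable k zr zw ε' :=
  ⟨hC.1, hC.2.1, fun A hA => (hC.2.2 A hA).imp fun _ hp => hp.mono h⟩

theorem plainDownload_readCost {F : Type u} [Fintype F] {n α : ℕ} (C : Scheme F n α)
    (D : Finset (Fin n)) (R : Finset (Fin α)) (dec : (D → R → F) → C.Secret) :
    (C.plainDownload D R dec).readCost = D.card * R.card := by
  simp [Protocol.readCost, Scheme.plainDownload]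

theorem plainDownload_commCost {F : Type u} [Fintype F] (hF : 1 < Fintype.card F) {n α : ℕ}
    (C : Scheme F n α) (D : Finset (Fin n)) (R : Finset (Fin α))
    (dec : (D → R → F) → C.Secret) :
    (C.plainDownload D R dec).commCost = D.card * R.card := by
  have h : ∀ i : D, Real.logb (Fintype.card F)
      (Fintype.card ((C.plainDownload D R dec).Msg i)) = R.card := by
    intro i
    have : Fintype.card ((C.plainDownload D R dec).Msg i) = Fintype.card F ^ R.card := by
      show Fintype.card (↥R → F) = _
      simp
    rw [this, Nat.cast_pow, Real.logb_pow, Real.logb_self_eq_one (by exact_mod_cast hF), mul_one]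
  rw [Protocol.commCost, Finset.sum_congr rfl fun i _ => h i]
  simp

theorem card_filter_val_lt {α w : ℕ} (hw : w ≤ α) :
    (Finset.univ.filter fun c : Fin α => (c : ℕ) < w).card = w := by
  rw [← Finset.card_map Fin.valEmbedding]
  convert Finset.card_range w
  ext c
  simp only [Finset.mem_map, Finset.mem_filter, Finset.mem_univ, true_and, Finset.mem_range]
  exact ⟨fun ⟨a, ha, h⟩ => h ▸ ha, fun h => ⟨⟨c, by omega⟩, h, rfl⟩⟩

variable {F : Type u} [Field F] {n t z zw N α : ℕ}

/-- The secret sits in `M_N`, the last block reached by the peeling; surplus parties in `E` are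
discarded so that exactly `e` remain. -/
theorem layoutSecret_eq_zero {ρ : Fin N → Fin N} (hz : z < t)
    (hdiv : ∀ e, t ≤ e → e ≤ N → (e - z) ∣ (t - z) * α) {x : Fin n → F}
    (hx : Function.Injective x) {E : Finset (Fin n)} {e : ℕ} (he : t ≤ e) (heN : e ≤ N)
    (hE : e ≤ E.card) {M : Matrix (Fin N) (Fin α) F} (hM : M ∈ layoutSubgroup F ρ t z α)
    (h : ∀ i ∈ E, ∀ c : Fin α, (c : ℕ) < stairWidth t z α e → layoutShares x N α M i c = 0) :
    layoutSecret ρ t z α M = 0 := by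
  obtain ⟨E', hE', rfl⟩ := Finset.exists_subset_card_eq hE
  funext p
  exact IsStaircaseLayout.eq_zero hz hdiv hx he hM (fun i hi c hc => h i (hE' hi) c hc) N heN
    le_rfl p.1.2 p.2.2 (fun hN => absurd hN (lt_irrefl N)) _

variable [Fintype F]

/-- Of d contacted parties, 2 zw are spent on errors, so the user needs only the columns that d - 2
zw honest parties would need. The size is (N - z)α_N = (t - z)α. -/
theorem layout_isReliable {ρ : Fin N → Fin N} (hz : z < t) (htN : t ≤ N)
    (hdiv : ∀ e, t ≤ e → e ≤ N → (e - z) ∣ (t - z) * α) {x : Fin n → F}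
    (hx : Function.Injective x) (hF : 1 < Fintype.card F) (hzn : z ≤ n)
    (hρ : ∀ Z : Finset (Fin n), Z.card = z → Completable ρ x t z Z)
    {U : Finset (Matrix (Fin N) (Fin α) F)} {hU : U.Nonempty}
    (hW : ∀ M, M ∈ U ↔ M ∈ layoutSubgroup F ρ t z α) :
    (uniformScheme U hU (layoutSecret ρ t z α) (layoutShares x N α)).IsReliable
      (t + 2 * zw) z zw 0 ∧
    (uniformScheme U hU (layoutSecret ρ t z α) (layoutShares x N α)).size =
      ((t - z : ℕ) : ℝ) * α ∧
    ∀ D : Finset (Fin n), t + 2 * zw ≤ D.card → D.card ≤ N + 2 * zw →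
      ∃ dec, ((uniformScheme U hU (layoutSecret ρ t z α)
        (layoutShares x N α)).plainDownload D (Finset.univ.filter fun c : Fin α =>
          (c : ℕ) < stairWidth t z α (D.card - 2 * zw)) dec).ErrorAtMost zw 0 := by
  classical
  have hpriv := uniformScheme_isPrivate (hU := hU) hW (sec := layoutSecret ρ t z α)
    (sh := layoutShares x N α) (zr := z) (fun Z hZ s => by
      obtain ⟨M, hM, hs, h0⟩ := exists_layout hz htN hdiv (hρ Z hZ) fun r c =>
        if h : (r : ℕ) + z < N ∧ (c : ℕ) < stairWidth t z α N then s ⟨(r, c), h⟩ else 0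
      refine ⟨M, hM, ?_, fun i hi => funext fun c => h0 i hi c⟩
      funext p
      refine (hs p.1.1 p.1.2 p.2.1 p.2.2).trans ?_
      rw [dif_pos p.2]) hzn
  refine ⟨⟨hpriv.1, ?_, ?_⟩, ?_, ?_⟩
  · refine uniformScheme_isResilient hW fun A hA M hM h => ?_
    exact layoutSecret_eq_zero hz hdiv hx le_rfl htN (E := A) (by omega) hM
      fun i hi c _ => congrFun (h i hi) c
  · intro A hA
    refine exists_decode_uniformScheme hW A Finset.univ fun E _ hE M hM h => ?_
    exact layoutSecret_eq_zero hz hdiv hx le_rfl htN (E := E) (by omega) hM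
      fun i hi c _ => h i hi c (Finset.mem_univ c)
  · rw [hpriv.2, Fintype.card_fun, card_layoutSecret_index hz htN,
      sub_mul_stairWidth (hdiv N htN le_rfl), Nat.cast_pow, Real.logb_pow,
      Real.logb_self_eq_one (by exact_mod_cast hF), mul_one, Nat.cast_mul]
  · intro D hD hDN
    refine exists_decode_uniformScheme hW D _ fun E _ hE M hM h => ?_
    exact layoutSecret_eq_zero hz hdiv hx (e := D.card - 2 * zw) (by omega) (by omega) (E := E)
      (by omega) hM fun i hi c hc => h i hi c (by simpa using hc)

/-- Some scheme is given by a layout that works for any distinct evaluation points. -/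
theorem exists_uniformScheme_shiftRows (F : Type u) [Field F] [Fintype F] (t z N α : ℕ) :
    ∃ (U : Finset (Matrix (Fin N) (Fin α) F)) (_ : U.Nonempty),
      ∀ M, M ∈ U ↔ M ∈ layoutSubgroup F (shiftRows N z) t z α := by
  classical
  exact ⟨Finset.univ.filter fun M => M ∈ layoutSubgroup F (shiftRows N z) t z α,
    ⟨0, by simp [zero_mem]⟩, fun M => by simp⟩

theorem exists_injective_points (F : Type u) [Fintype F] (hq : n ≤ Fintype.card F) :
    ∃ x : Fin n → F, Function.Injective x := by
  obtain ⟨x⟩ := Function.Embedding.nonempty_of_card_le (α := Fin n) (β := F) (by simpa using hq)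
  exact ⟨x, x.injective⟩

theorem omniscientCapacity_of_lt {k zro zwo zrw : ℕ} (hc : 3 * zrw + 2 * zwo + zro < k) (α : ℕ) :
    omniscientCapacity k zro zwo zrw α =
      ((k - 2 * (zwo + zrw) - (zro + zrw) : ℕ) : ℝ) * α := by
  rw [omniscientCapacity, if_pos hc, Nat.cast_sub (by omega), Nat.cast_sub (by omega)]
  push_cast
  ring

/-- A constant secret attains capacity 0 when k ≤ c. -/
theorem exists_isReliable_size_eq_zero {k zr : ℕ} (hzn : zr ≤ n) :
    ∃ C : Scheme F n α, C.IsReliable k zr zw 0 ∧ C.size = 0 := by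
  classical
  have hW : ∀ v : PUnit.{1}, v ∈ (Finset.univ : Finset PUnit.{1}) ↔
      v ∈ (⊤ : AddSubgroup PUnit.{1}) := by simp
  have hpriv := uniformScheme_isPrivate (F := F) (n := n) (α := α) (hU := Finset.univ_nonempty)
    hW (sec := (0 : PUnit.{1} →+ PUnit.{u + 1})) (sh := 0) (zr := zr)
    (fun Z hZ s => ⟨0, by simp, rfl, fun i _ => rfl⟩) hzn
  refine ⟨_, ⟨hpriv.1, ?_, ?_⟩, ?_⟩
  · exact uniformScheme_isResilient hW fun _ _ _ _ _ => rfl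
  · exact fun A _ => exists_decode_uniformScheme hW A Finset.univ fun _ _ _ _ _ _ => rfl
  · rw [hpriv.2]
    simp

theorem omniscientCapacity_mem_achievableSizes {k zro zwo zrw : ℕ} (hkn : k ≤ n)
    (hzr : zro + zrw < k) (hq : n ≤ Fintype.card F) :
    omniscientCapacity k zro zwo zrw α ∈
      achievableSizes F n k (zro + zrw) (zwo + zrw) α := by
  intro ε hε
  by_cases hc : 3 * zrw + 2 * zwo + zro < k
  · obtain ⟨x, hx⟩ := exists_injective_points F hq
    set t := k - 2 * (zwo + zrw) with ht
    have hz : zro + zrw < t := by omega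
    -- Taking N = t leaves a single block of width α, a ramp version of Shamir's scheme, so capacity
    -- needs no divisibility condition.
    obtain ⟨U, hU, hW⟩ := exists_uniformScheme_shiftRows F t (zro + zrw) t α
    obtain ⟨h1, h2, -⟩ := layout_isReliable (zw := zwo + zrw) hz le_rfl
      (fun e h1 h2 => by rw [le_antisymm h2 h1]; exact dvd_mul_right _ _) hx
      Fintype.one_lt_card (by omega) (fun Z hZ => completable_shiftRows hx hz hZ)
      (hU := hU) hW
    rw [show t + 2 * (zwo + zrw) = k by omega] at h1
    refine ⟨_, h1.mono hε.le, ?_⟩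
    rw [h2, omniscientCapacity_of_lt hc]
  · obtain ⟨C, h1, h2⟩ := exists_isReliable_size_eq_zero (F := F) (n := n) (α := α) (k := k)
      (zr := zro + zrw) (zw := zwo + zrw) (by omega)
    refine ⟨C, h1.mono hε.le, ?_⟩
    rw [h2, omniscientCapacity, if_neg hc]

/-- Divisibility makes the natural-number quotient in `stairWidth` exact, so it agrees with the real
quotient. -/
theorem optimalCost_eq {k zro zwo zrw d : ℕ} (hc : 3 * zrw + 2 * zwo + zro < k) (hd : k ≤ d)
    (hdiv : (d - (3 * zrw + 2 * zwo + zro)) ∣ (k - (3 * zrw + 2 * zwo + zro)) * α) :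
    optimalCost k zro zwo zrw α d = (d : ℝ) *
      stairWidth (k - 2 * (zwo + zrw)) (zro + zrw) α (d - 2 * (zwo + zrw)) := by
  have h1 : stairWidth (k - 2 * (zwo + zrw)) (zro + zrw) α (d - 2 * (zwo + zrw)) =
      (k - (3 * zrw + 2 * zwo + zro)) * α / (d - (3 * zrw + 2 * zwo + zro)) := by
    rw [stairWidth,
      show d - 2 * (zwo + zrw) - (zro + zrw) = d - (3 * zrw + 2 * zwo + zro) by omega,
      show k - 2 * (zwo + zrw) - (zro + zrw) = k - (3 * zrw + 2 * zwo + zro) by omega]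
  have h2 : (0 : ℝ) < ((d - (3 * zrw + 2 * zwo + zro) : ℕ) : ℝ) := by
    have : 0 < d - (3 * zrw + 2 * zwo + zro) := by omega
    exact_mod_cast this
  rw [h1, Nat.cast_div hdiv h2.ne', optimalCost, Nat.cast_mul, Nat.cast_sub hc.le,
    Nat.cast_sub (hc.le.trans hd), mul_div_assoc]
  congr 2 <;> push_cast <;> ring

/-- If the layout allows for privacy, the code is optimal for all numbers of contacted parties. -/
theorem layout_isOptimal {k zro zwo zrw : ℕ} (hkn : k ≤ n) (hc : 3 * zrw + 2 * zwo + zro < k)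
    (hdiv : ∀ d : ℕ, k ≤ d → d ≤ n →
      (d - (3 * zrw + 2 * zwo + zro)) ∣ (k - (3 * zrw + 2 * zwo + zro)) * α)
    {ρ : Fin (n - 2 * (zwo + zrw)) → Fin (n - 2 * (zwo + zrw))} {x : Fin n → F}
    (hx : Function.Injective x)
    (hρ : ∀ Z : Finset (Fin n), Z.card = zro + zrw →
      Completable ρ x (k - 2 * (zwo + zrw)) (zro + zrw) Z)
    {U : Finset (Matrix (Fin (n - 2 * (zwo + zrw))) (Fin α) F)} {hU : U.Nonempty}
    (hW : ∀ M, M ∈ U ↔ M ∈ layoutSubgroup F ρ (k - 2 * (zwo + zrw)) (zro + zrw) α)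
    {C : Scheme F n α} (hC : C = uniformScheme U hU
      (layoutSecret ρ (k - 2 * (zwo + zrw)) (zro + zrw) α) (layoutShares x _ α)) :
    C.IsReliable k (zro + zrw) (zwo + zrw) 0 ∧
    C.size = omniscientCapacity k zro zwo zrw α ∧
    ∀ D : Finset (Fin n), k ≤ D.card →
      ∃ dec, ∃ p : Protocol C D,
        p = C.plainDownload D (Finset.univ.filter fun c : Fin α => (c : ℕ) <
          stairWidth (k - 2 * (zwo + zrw)) (zro + zrw) α (D.card - 2 * (zwo + zrw))) dec ∧
        p.ErrorAtMost (zwo + zrw) 0 ∧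
        p.commCost = optimalCost k zro zwo zrw α D.card ∧
        p.readCost = optimalCost k zro zwo zrw α D.card := by
  subst hC
  obtain ⟨h1, h2, h3⟩ := layout_isReliable (zw := zwo + zrw)
    (show zro + zrw < k - 2 * (zwo + zrw) by omega) (by omega) (fun e he heN => by
      have h := hdiv (e + 2 * (zwo + zrw)) (by omega) (by omega)
      rwa [show e + 2 * (zwo + zrw) - (3 * zrw + 2 * zwo + zro) = e - (zro + zrw) by omega,
        show k - (3 * zrw + 2 * zwo + zro) = k - 2 * (zwo + zrw) - (zro + zrw) by omega] at h)
    hx Fintype.one_lt_card (by omega) hρ (hU := hU) hW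
  rw [show k - 2 * (zwo + zrw) + 2 * (zwo + zrw) = k by omega] at h1 h3
  refine ⟨h1, by rw [h2, omniscientCapacity_of_lt hc], fun D hD => ?_⟩
  have hDn : D.card ≤ n := by simpa using D.card_le_univ
  obtain ⟨dec, hdec⟩ := h3 D hD (by omega)
  have hw := stairWidth_le (α := α) (show zro + zrw < k - 2 * (zwo + zrw) by omega)
    (show k - 2 * (zwo + zrw) ≤ D.card - 2 * (zwo + zrw) by omega)
  refine ⟨dec, _, rfl, hdec, ?_, ?_⟩
  · rw [plainDownload_commCost Fintype.one_lt_card, card_filter_val_lt hw,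
      optimalCost_eq hc hD (hdiv _ hD hDn)]
  · rw [plainDownload_readCost, card_filter_val_lt hw, optimalCost_eq hc hD (hdiv _ hD hDn)]

end Optimal

end SecretSharing

/-! ### Capacity, minimum costs and Staircase codes. -/

theorem theorem2 {F : Type u} [Field F] [Fintype F] (n k zro zwo zrw α : ℕ)
    (hkn : k ≤ n) (hzr : zro + zrw < k) (hq : n ≤ Fintype.card F) :
    -- the capacity
    IsGreatest (SecretSharing.achievableSizes F n k (zro + zrw) (zwo + zrw) α)
      (SecretSharing.omniscientCapacity k zro zwo zrw α) ∧
    (3 * zrw + 2 * zwo + zro < k →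
      -- no capacity-achieving schemes have smaller communication or read costs
      (∀ D : Finset (Fin n), k ≤ D.card →
        SecretSharing.optimalCost k zro zwo zrw α D.card ∈
            lowerBounds (SecretSharing.commCosts F n k (zro + zrw) (zwo + zrw) α
              (SecretSharing.omniscientCapacity k zro zwo zrw α) D) ∧
        SecretSharing.optimalCost k zro zwo zrw α D.card ∈
            lowerBounds (SecretSharing.readCosts F n k (zro + zrw) (zwo + zrw) α
              (SecretSharing.omniscientCapacity k zro zwo zrw α) D)) ∧
      -- the case in which the number of symbols per contacted party is an integer for every `d`
      ((∀ d : ℕ, k ≤ d → d ≤ n →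
          (d - (3 * zrw + 2 * zwo + zro)) ∣ (k - (3 * zrw + 2 * zwo + zro)) * α) →
        -- the minimum communication and read costs
        (∀ D : Finset (Fin n), k ≤ D.card →
          IsLeast (SecretSharing.commCosts F n k (zro + zrw) (zwo + zrw) α
              (SecretSharing.omniscientCapacity k zro zwo zrw α) D)
            (SecretSharing.optimalCost k zro zwo zrw α D.card) ∧
          IsLeast (SecretSharing.readCosts F n k (zro + zrw) (zwo + zrw) α
              (SecretSharing.omniscientCapacity k zro zwo zrw α) D)
            (SecretSharing.optimalCost k zro zwo zrw α D.card)) ∧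
        -- a zero-error scheme attains the capacity and all the minimum costs simultaneously
        (∃ C : SecretSharing.Scheme F n α,
          C.IsReliable k (zro + zrw) (zwo + zrw) 0 ∧
          C.size = SecretSharing.omniscientCapacity k zro zwo zrw α ∧
          ∀ D : Finset (Fin n), k ≤ D.card → ∃ p : SecretSharing.Protocol C D,
            p.ErrorAtMost (zwo + zrw) 0 ∧
            p.commCost = SecretSharing.optimalCost k zro zwo zrw α D.card ∧
            p.readCost = SecretSharing.optimalCost k zro zwo zrw α D.card) ∧
        -- Staircase codes are such schemes: the user downloads a prefix of each contacted share
        (∀ x : Fin n → F, Function.Injective x → (∀ i, x i ≠ 0) →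
          ∀ C : SecretSharing.Scheme F n α,
            C = SecretSharing.staircaseCode x (k - 2 * (zwo + zrw)) (zro + zrw)
              (n - 2 * (zwo + zrw)) α →
            C.IsReliable k (zro + zrw) (zwo + zrw) 0 ∧
            C.size = SecretSharing.omniscientCapacity k zro zwo zrw α ∧
            ∀ D : Finset (Fin n), k ≤ D.card →
              ∃ dec, ∃ p : SecretSharing.Protocol C D,
                p = C.plainDownload D
                  (Finset.univ.filter fun c : Fin α => (c : ℕ) <
                    SecretSharing.stairWidth (k - 2 * (zwo + zrw)) (zro + zrw) α
                      (D.card - 2 * (zwo + zrw))) dec ∧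
                p.ErrorAtMost (zwo + zrw) 0 ∧
                p.commCost = SecretSharing.optimalCost k zro zwo zrw α D.card ∧
                p.readCost = SecretSharing.optimalCost k zro zwo zrw α D.card))) := by 
  classical
  have hF : 1 < Fintype.card F := Fintype.one_lt_card
  refine ⟨⟨SecretSharing.omniscientCapacity_mem_achievableSizes hkn hzr hq,
    fun H hH => SecretSharing.le_omniscientCapacity hF hkn hzr hH⟩, fun hc => ?_⟩
  have hlow := fun (D : Finset (Fin n)) (hD : k ≤ D.card) =>
    And.intro (fun κ hκ => SecretSharing.optimalCost_le_of_mem_commCosts (α := α) hF hkn hc hD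
      (κ := κ) hκ)
      (fun κ hκ => SecretSharing.optimalCost_le_of_mem_commCosts (α := α) hF hkn hc hD (κ := κ)
        (SecretSharing.readCosts_subset_commCosts hF _ _ _ _ D hκ))
  refine ⟨hlow, fun hdiv => ?_⟩
  have hex : ∃ C : SecretSharing.Scheme F n α,
      C.IsReliable k (zro + zrw) (zwo + zrw) 0 ∧
      C.size = SecretSharing.omniscientCapacity k zro zwo zrw α ∧
      ∀ D : Finset (Fin n), k ≤ D.card → ∃ p : SecretSharing.Protocol C D,
        p.ErrorAtMost (zwo + zrw) 0 ∧
        p.commCost = SecretSharing.optimalCost k zro zwo zrw α D.card ∧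
        p.readCost = SecretSharing.optimalCost k zro zwo zrw α D.card := by
    -- Only q ≥ n is available, so 0 may be among the points; hence the shifted layout.
    obtain ⟨x, hx⟩ := SecretSharing.exists_injective_points F hq
    obtain ⟨U, hU, hW⟩ := SecretSharing.exists_uniformScheme_shiftRows F
      (k - 2 * (zwo + zrw)) (zro + zrw) (n - 2 * (zwo + zrw)) α
    obtain ⟨h1, h2, h3⟩ := SecretSharing.layout_isOptimal hkn hc hdiv hx
      (fun Z hZ => SecretSharing.completable_shiftRows hx (by omega) hZ) (hU := hU) hW rfl
    refine ⟨_, h1, h2, fun D hD => ?_⟩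
    obtain ⟨-, p, -, hp⟩ := h3 D hD
    exact ⟨p, hp⟩
  refine ⟨fun D hD => ?_, hex, fun x hx hx0 C hC => ?_⟩
  · obtain ⟨C, h1, h2, h3⟩ := hex
    obtain ⟨p, hp, hcomm, hread⟩ := h3 D hD
    exact ⟨⟨fun ε hε => ⟨C, h1.mono hε.le, h2.ge, p, hp.mono hε.le, hcomm.le⟩, (hlow D hD).1⟩,
      ⟨fun ε hε => ⟨C, h1.mono hε.le, h2.ge, p, hp.mono hε.le, hread.le⟩, (hlow D hD).2⟩⟩
  · obtain ⟨U, hU, hW, heq⟩ := SecretSharing.staircaseCode_eq_uniformScheme x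
      (k - 2 * (zwo + zrw)) (zro + zrw) (n - 2 * (zwo + zrw)) α
    exact SecretSharing.layout_isOptimal hkn hc hdiv hx
      (fun Z hZ => SecretSharing.completable_id hx hx0 (by omega) hZ) hW (hC.trans heq)
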